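/- For $\chi\colon\mathbf{Z}/N\mathbf{Z}\to\mathbf{C}$ and integers $k\ge 0$, $n\ge 1$, define the $\chi$-weighted divisor and conjugate divisor functions $$\sigma_k(n;\chi)=\sum_{d\mid n}\chi(d\bmod N)\,d^k,\qquad \sigma^{\mathrm c}_k(n;\chi)=\sum_{d\mid n}\chi\bigl((n/d)\bmod N\bigr)\,d^k,$$ where $d$ runs over the positive divisors of $n$; the argument $\chi$ is written out as its list of values $\chi(0),\dots,\chi(N-1)$. Let $r_{2s}(n)$, $n\ge 1$, resp. $t_{2s}(n)$, $n\ge 0$, denote the number of ways of representing the integer $n$ as an ordered sum of $2s$ squares $m^2$, resp. $2s$ triangles $m(m+1)/2$, with each $m$ ranging over all of $\mathbf{Z}$ (i.e., the number of tuples $(m_1,\dots,m_{2s})\in\mathbf{Z}^{2s}$ with $\sum_i m_i^2=n$, resp. $\sum_i m_i(m_i+1)/2=n$). Theorem. For all integers $n\ge 1$, $$\begin{aligned} r_2(n) &= 4\,\sigma_0(n;0,1,0,-1),\\ r_4(n) &= 8\,\sigma_1(n;0,1,1,1) = 8\,\sigma^{\mathrm c}_1(n;-3,1,1,1),\\ r_6(n)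 &= 16\,\sigma^{\mathrm c}_2(n;0,1,0,-1) - 4\,\sigma_2(n;0,1,0,-1),\\ r_8(n) &= 4\,\sigma_3(n;4,4,3,4) = 16\,\sigma^{\mathrm c}_3(n;15,1,-1,1), \end{aligned}$$ and for all integers $n\ge 0$, $$\begin{aligned} t_2(n) &= 4\,\sigma_0(4n+1;0,1,-1,-1,0,1,1,-1) = 4\,\sigma_0(8n+2;0,1,0,-1),\\ t_4(n) &= 8\,\sigma_1(2n+1;0,2,-1,2) = 16\,\sigma^{\mathrm c}_1(2n+1;0,1,-2,1)\\ &= 16\,\sigma_1(2n+1;1) = 16\,\sigma^{\mathrm c}_1(2n+1;1),\\ t_6(n) &= \sigma_2(4n+3;0,-4,1,4,0,-4,-1,4) + 4\,\sigma^{\mathrm c}_2(4n+3;0,1,-4,-1,0,1,4,-1)\\ &= 8\,\sigma_2(4n+3;0,-1,0,1),\\ t_8(n) &= 4\,\sigma_3(2n+2;7,0,8,0) = 256\,\sigma^{\mathrm c}_3(2n+2;0,0,1,0)\\ &= 32\,\sigma_3(n+1;7,8) = 256\,\sigma^{\mathrm c}_3(n+1;0,1). \end{aligned}$$ -/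

import Mathlib

/-- The `χ`-weighted divisor function `σ_k(n; χ) = ∑_{d ∣ n} χ(d mod N) d^k`, for an arbitrary
function `χ` on `ℤ/Nℤ` and `n ≥ 1`. -/
noncomputable def weightedSigma {N : ℕ} (k n : ℕ) (χ : ZMod N → ℂ) : ℂ :=
  ∑ d ∈ n.divisors, χ (d : ZMod N) * (d : ℂ) ^ k

/-- The `χ`-weighted conjugate divisor function `σᶜ_k(n; χ) = ∑_{d ∣ n} χ((n/d) mod N) d^k`, for an
arbitrary function `χ` on `ℤ/Nℤ` and `n ≥ 1`. The division `n / d` is exact. -/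
noncomputable def weightedSigmaConj {N : ℕ} (k n : ℕ) (χ : ZMod N → ℂ) : ℂ :=
  ∑ d ∈ n.divisors, χ ((n / d : ℕ) : ZMod N) * (d : ℂ) ^ k

/-- The function `χ` on `ℤ/Nℤ` whose list of values `χ(0), …, χ(N-1)` is `c`. -/
def weights (N : ℕ) [NeZero N] (c : Fin N → ℂ) : ZMod N → ℂ :=
  fun a => c ⟨a.val, ZMod.val_lt a⟩

/-- The number of ordered `k`-tuples of integers whose squares sum to `n`. -/
noncomputable def squareReps (k n : ℕ) : ℕ :=
  {x : Fin k → ℤ | ∑ i, x i ^ 2 = (n : ℤ)}.ncard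

/-- The number of ordered `k`-tuples of integers `m_1, …, m_k`, each ranging over all of `ℤ`, such
that the triangular numbers `m_i (m_i + 1) / 2` (an exact division) sum to `n`. -/
noncomputable def triangleReps (k n : ℕ) : ℕ :=
  {x : Fin k → ℤ | ∑ i, x i * (x i + 1) / 2 = (n : ℤ)}.ncard

/-- The set counted by `squareReps` is finite, so that its `ncard` is its number of elements. -/
theorem squareReps_finite (k n : ℕ) : {x : Fin k → ℤ | ∑ i, x i ^ 2 = (n : ℤ)}.Finite := by
  refine (Set.Finite.pi' (fun _ : Fin k => Set.finite_Icc (-(n : ℤ)) n)).subset ?_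
  intro x hx i
  have h : x i ^ 2 ≤ ∑ j, x j ^ 2 :=
    Finset.single_le_sum (f := fun j => x j ^ 2) (fun j _ => sq_nonneg (x j)) (Finset.mem_univ i)
  have hn : x i ^ 2 ≤ (n : ℤ) := h.trans (le_of_eq hx)
  exact ⟨by nlinarith, by nlinarith⟩

/-- The set counted by `triangleReps` is finite, so that its `ncard` is its number of elements. -/
theorem triangleReps_finite (k n : ℕ) :
    {x : Fin k → ℤ | ∑ i, x i * (x i + 1) / 2 = (n : ℤ)}.Finite := by
  refine (Set.Finite.pi' (fun _ : Fin k => Set.finite_Icc (-(2 * n + 2 : ℤ)) (2 * n + 2))).subset ?_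
  intro x hx i
  have h0 : ∀ m : ℤ, 0 ≤ m * (m + 1) := fun m => by
    rcases le_or_gt 0 m with hm | hm <;> nlinarith
  have h : x i * (x i + 1) / 2 ≤ ∑ j, x j * (x j + 1) / 2 :=
    Finset.single_le_sum (f := fun j => x j * (x j + 1) / 2)
      (fun j _ => Int.ediv_nonneg (h0 (x j)) (by norm_num)) (Finset.mem_univ i)
  have hn : x i * (x i + 1) / 2 ≤ (n : ℤ) := h.trans (le_of_eq hx)
  have h2 : x i * (x i + 1) ≤ 2 * n + 1 := by omega
  exact ⟨by nlinarith, by nlinarith⟩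

/-!
Let `r(n)` be the number of `s`-tuples of integers, or of odd integers, whose squares sum to `n`.
All entries of an `s + 1`-tuple with sum of squares `n` contribute equally on average, so
`∑ v, (n - (s + 1) v ^ 2) r(n - v ^ 2) = 0`, where `v` runs over the integers, or over the odd
integers (`sum_mul_card_sqTuples_eq_zero`). This recursion determines `r`. The number of
representations by triangles is that of `8 n + s` by odd squares, because
`8 (m (m + 1) / 2) + 1 = (2 m + 1) ^ 2` (`triangleReps_eq_card`). So it suffices to find weights `w`
for which the divisor sum `∑ w d e` over `d * e = n` obeys the same recursion
(`mul_card_sqTuples_eq_sum`, `mul_card_sqTuples_odd_eq_sum`), which is a statement on the sum of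
`(d e - s u ^ 2) w d e` over the set of triples `(u, d, e)` with `u ^ 2 + d e = n` and `d, e > 0`.

The tool for such sums is an identity of Liouville (`sum_liouvilleTerm`). If `F x y z` is odd in `x`
and even in `(y, z)`, then
`∑ (2 F (e - 2 u) (u + d) (2 u + 2 d - e) - F (d + e) u (d - e))` over the triples is zero if `n` is
not a square, and is an explicit sum over `0 < j < 2 l` if `n = l ^ 2`. It is proved by involutions
of the set of triples. For each of the weights `w` there is a polynomial with periodic coefficients
`F` such that the two summands agree after averaging over the symmetries `u ↦ -u` and `d ↔ e` of the
set of triples. This agreement is an identity of polynomials in each residue class.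

For two triangles no second recursion is needed, since in any representation of `8 n + 2` as a sum
of two squares both entries are odd. The remaining equalities between divisor sums come from moving
a factor `k` from one divisor to the complementary one (`sum_factorPairs_mul_left`,
`sum_factorPairs_mul_right`, `sum_factorPairs_move`).
-/

/-! ### Tuples of squares and the recursion for their number -/

/-- The `k`-tuples of integers with all entries satisfying `P` whose squares sum to `n`. -/
noncomputable def sqTuples (P : ℤ → Prop) [DecidablePred P] (k : ℕ) (n : ℤ) :
    Finset (Fin k → ℤ) :=
  (Fintype.piFinset fun _ => Finset.Icc (-n) n).filter fun x => (∀ i, P (x i)) ∧ ∑ i, x i ^ 2 = n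

section Tuples

variable {P : ℤ → Prop} [DecidablePred P] {k : ℕ}

theorem mem_Icc_of_sq_le {v n : ℤ} (h : v ^ 2 ≤ n) : v ∈ Finset.Icc (-n) n :=
  Finset.mem_Icc.2 ⟨by nlinarith, by nlinarith⟩

theorem mem_sqTuples {n : ℤ} {x : Fin k → ℤ} :
    x ∈ sqTuples P k n ↔ (∀ i, P (x i)) ∧ ∑ i, x i ^ 2 = n := by
  simp only [sqTuples, Finset.mem_filter, Fintype.mem_piFinset, and_iff_right_iff_imp]
  rintro ⟨-, h⟩ i
  refine mem_Icc_of_sq_le (h ▸ ?_)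
  exact Finset.single_le_sum (f := fun j => x j ^ 2) (fun j _ => sq_nonneg (x j))
    (Finset.mem_univ i)

theorem sqTuples_eq_empty_of_neg {n : ℤ} (hn : n < 0) : sqTuples P k n = ∅ := by
  refine Finset.eq_empty_of_forall_notMem fun x hx => ?_
  have h := (mem_sqTuples.1 hx).2
  have : 0 ≤ ∑ i, x i ^ 2 := Finset.sum_nonneg fun i _ => sq_nonneg (x i)
  omega

/-- Fixing the first entry `v` of a `k + 1`-tuple leaves a `k`-tuple for `n - v ^ 2`. -/
theorem card_filter_sqTuples_succ {n v : ℤ} (hv : P v) :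
    ((sqTuples P (k + 1) n).filter fun x => x 0 = v).card = (sqTuples P k (n - v ^ 2)).card := by
  refine Finset.card_nbij' (fun x => Fin.tail x) (fun y => Fin.cons v y) ?_ ?_ ?_ ?_
  · intro x hx
    simp only [Finset.coe_filter, mem_sqTuples, Set.mem_ofPred_eq, Fin.sum_univ_succ] at hx
    obtain ⟨⟨h1, h2⟩, rfl⟩ := hx
    simp only [Finset.mem_coe, mem_sqTuples, Fin.tail]
    exact ⟨fun i => h1 _, by linarith⟩
  · intro y hy
    simp only [Finset.mem_coe, mem_sqTuples] at hy
    simp only [Finset.coe_filter, mem_sqTuples, Set.mem_ofPred_eq, Fin.sum_univ_succ, Fin.cons_zero,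
      Fin.cons_succ, and_true]
    refine ⟨fun i => ?_, by linarith⟩
    refine Fin.cases ?_ (fun j => ?_) i
    · simpa using hv
    · simpa using hy.1 j
  · intro x hx
    simp only [Finset.coe_filter, Set.mem_ofPred_eq] at hx
    rw [← hx.2]
    exact Fin.cons_self_tail x
  · intro y _
    exact Fin.tail_cons (α := fun _ => ℤ) v y

/-- By symmetry each of the `k + 1` entries contributes equally to the sum of the squares, so that
`n - (k + 1) v ^ 2`, with `v` the first entry, averages to zero. -/
theorem sum_mul_card_sqTuples_eq_zero (P : ℤ → Prop) [DecidablePred P] (k : ℕ) (n : ℤ) :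
    ∑ v ∈ (Finset.Icc (-n) n).filter P,
      (n - (k + 1) * v ^ 2) * ((sqTuples P k (n - v ^ 2)).card : ℤ) = 0 := by
  have key : ∑ x ∈ sqTuples P (k + 1) n, (n - (k + 1) * x 0 ^ 2) = 0 := by
    have hsym : ∀ i : Fin (k + 1),
        ∑ x ∈ sqTuples P (k + 1) n, x i ^ 2 = ∑ x ∈ sqTuples P (k + 1) n, x 0 ^ 2 := by
      intro i
      refine Finset.sum_nbij' (fun x => x ∘ Equiv.swap 0 i) (fun x => x ∘ Equiv.swap 0 i)
        ?_ ?_ ?_ ?_ ?_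
      · intro x hx
        rw [mem_sqTuples] at hx ⊢
        exact ⟨fun j => hx.1 _, by
          rw [← hx.2]; exact Equiv.sum_comp (Equiv.swap 0 i) fun j => x j ^ 2⟩
      · intro x hx
        rw [mem_sqTuples] at hx ⊢
        exact ⟨fun j => hx.1 _, by
          rw [← hx.2]; exact Equiv.sum_comp (Equiv.swap 0 i) fun j => x j ^ 2⟩
      · intro x _; ext j; simp
      · intro x _; ext j; simp
      · intro x _; simp
    have htot : ∑ x ∈ sqTuples P (k + 1) n, n = (k + 1) * ∑ x ∈ sqTuples P (k + 1) n, x 0 ^ 2 := by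
      calc ∑ x ∈ sqTuples P (k + 1) n, n = ∑ x ∈ sqTuples P (k + 1) n, ∑ i, x i ^ 2 :=
            Finset.sum_congr rfl fun x hx => (mem_sqTuples.1 hx).2.symm
        _ = ∑ i : Fin (k + 1), ∑ x ∈ sqTuples P (k + 1) n, x i ^ 2 := Finset.sum_comm
        _ = _ := by simp [hsym]
    rw [Finset.sum_sub_distrib, htot, Finset.mul_sum, sub_self]
  rw [← key, ← Finset.sum_fiberwise_of_maps_to (s := sqTuples P (k + 1) n) (g := fun x => x 0)
    (t := (Finset.Icc (-n) n).filter P)]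
  · refine Finset.sum_congr rfl fun v hv => ?_
    rw [Finset.sum_congr rfl (g := fun _ => n - (k + 1) * v ^ 2)]
    · rw [Finset.sum_const, card_filter_sqTuples_succ (Finset.mem_filter.1 hv).2, nsmul_eq_mul,
        mul_comm]
    · intro x hx
      rw [(Finset.mem_filter.1 hx).2]
  · intro x hx
    have h := mem_sqTuples.1 hx
    refine Finset.mem_filter.2 ⟨mem_Icc_of_sq_le ?_, h.1 0⟩
    rw [← h.2]
    exact Finset.single_le_sum (f := fun j => x j ^ 2) (fun j _ => sq_nonneg (x j))
      (Finset.mem_univ 0)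

theorem card_sqTuples_zero (k : ℕ) : (sqTuples (fun _ => True) k 0).card = 1 := by
  rw [Finset.card_eq_one]
  refine ⟨0, Finset.ext fun x => ?_⟩
  rw [mem_sqTuples, Finset.mem_singleton,
    Finset.sum_eq_zero_iff_of_nonneg fun i _ => sq_nonneg (x i)]
  simp [funext_iff]

theorem one_le_sq_of_odd {v : ℤ} (hv : Odd v) : 1 ≤ v ^ 2 := by
  have : v ≠ 0 := by rintro rfl; simp at hv
  have := sq_pos_of_ne_zero this
  omega

theorem card_sqTuples_odd_of_lt {n : ℤ} (hn : n < k) : (sqTuples Odd k n).card = 0 := by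
  rw [Finset.card_eq_zero]
  refine Finset.eq_empty_of_forall_notMem fun x hx => ?_
  obtain ⟨h1, h2⟩ := mem_sqTuples.1 hx
  have : ∑ _i : Fin k, (1 : ℤ) ≤ ∑ i, x i ^ 2 :=
    Finset.sum_le_sum fun i _ => one_le_sq_of_odd (h1 i)
  simp at this
  omega

theorem card_sqTuples_odd_self (k : ℕ) : (sqTuples Odd k k).card = 2 ^ k := by
  have : sqTuples Odd k k = Fintype.piFinset fun _ => ({1, -1} : Finset ℤ) := by
    ext x
    rw [mem_sqTuples, Fintype.mem_piFinset]
    simp only [Finset.mem_insert, Finset.mem_singleton]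
    constructor
    · rintro ⟨h1, h2⟩ i
      have h3 : ∑ i, (x i ^ 2 - 1) = 0 := by simp [h2]
      rw [Finset.sum_eq_zero_iff_of_nonneg
        fun i _ => sub_nonneg.2 (one_le_sq_of_odd (h1 i))] at h3
      have h4 := h3 i (Finset.mem_univ i)
      exact sq_eq_one_iff.1 (by linarith)
    · intro h
      have h' : ∀ i, x i ^ 2 = 1 := fun i => by rcases h i with h | h <;> simp [h]
      refine ⟨fun i => ?_, by simp [h']⟩
      rcases h i with h | h <;> rw [h]
      · exact odd_one
      · exact odd_neg_one
  rw [this, Fintype.card_piFinset]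
  simp

theorem squareReps_eq_card (k n : ℕ) :
    squareReps k n = (sqTuples (fun _ => True) k n).card := by
  rw [squareReps, ← Set.ncard_coe_finset]
  congr 1
  ext x
  simp [mem_sqTuples]

/-- `8 m (m + 1) / 2 + 1 = (2 m + 1) ^ 2`: tuples of triangles correspond to tuples of odd
squares. -/
theorem triangleReps_eq_card (k n : ℕ) :
    triangleReps k n = (sqTuples Odd k (8 * n + k)).card := by
  have hval : ∀ m : ℤ, 8 * (m * (m + 1) / 2) + 1 = (2 * m + 1) ^ 2 := fun m => by
    obtain ⟨c, hc⟩ := (Int.even_mul_succ_self m).two_dvd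
    rw [hc, Int.mul_ediv_cancel_left _ two_ne_zero]
    linear_combination 4 * hc.symm
  have hsum : ∀ x : Fin k → ℤ,
      ∑ i, (2 * x i + 1) ^ 2 = 8 * ∑ i, x i * (x i + 1) / 2 + k := fun x => by
    simp_rw [← hval, Finset.sum_add_distrib, Finset.mul_sum]
    simp
  rw [triangleReps, ← Set.ncard_coe_finset]
  refine Set.ncard_congr (fun x _ i => 2 * x i + 1) ?_ ?_ ?_
  · intro x hx
    simp only [Set.mem_ofPred_eq] at hx
    rw [Finset.mem_coe, mem_sqTuples, hsum, hx]
    exact ⟨fun i => ⟨x i, rfl⟩, rfl⟩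
  · intro x y _ _ h
    funext i
    have : 2 * x i + 1 = 2 * y i + 1 := congrFun h i
    omega
  · intro y hy
    rw [Finset.mem_coe, mem_sqTuples] at hy
    choose x hx using hy.1
    obtain rfl : y = fun i => 2 * x i + 1 := funext hx
    refine ⟨x, ?_, rfl⟩
    have := hy.2
    rw [hsum] at this
    simp only [Set.mem_ofPred_eq]
    linarith

end Tuples

/-! ### Factorizations and triples -/

/-- The pairs `(d, e)` of positive integers with `d * e = n`. -/
noncomputable def factorPairs (n : ℤ) : Finset (ℤ × ℤ) :=
  (Finset.Icc 1 n ×ˢ Finset.Icc 1 n).filter fun p => p.1 * p.2 = n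

/-- The triples `(u, d, e)` of integers with `u ^ 2 + d * e = n` and `d`, `e` positive. -/
noncomputable def liouvilleTriples (n : ℤ) : Finset (ℤ × ℤ × ℤ) :=
  (Finset.Icc (-n) n ×ˢ Finset.Icc 1 n ×ˢ Finset.Icc 1 n).filter
    fun p => p.1 ^ 2 + p.2.1 * p.2.2 = n

theorem mem_factorPairs {n d e : ℤ} :
    (d, e) ∈ factorPairs n ↔ 0 < d ∧ 0 < e ∧ d * e = n := by
  simp only [factorPairs, Finset.mem_filter, Finset.mem_product, Finset.mem_Icc]
  constructor
  · rintro ⟨⟨⟨h1, -⟩, h2, -⟩, h3⟩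
    exact ⟨by omega, by omega, h3⟩
  · rintro ⟨h1, h2, h3⟩
    refine ⟨⟨⟨by omega, ?_⟩, by omega, ?_⟩, h3⟩ <;> nlinarith

theorem factorPairs_of_nonpos {n : ℤ} (hn : n ≤ 0) : factorPairs n = ∅ := by
  refine Finset.eq_empty_of_forall_notMem fun ⟨d, e⟩ h => ?_
  obtain ⟨h1, h2, h3⟩ := mem_factorPairs.1 h
  have := mul_pos h1 h2
  omega

theorem mem_liouvilleTriples {n u d e : ℤ} :
    (u, d, e) ∈ liouvilleTriples n ↔ 0 < d ∧ 0 < e ∧ u ^ 2 + d * e = n := by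
  simp only [liouvilleTriples, Finset.mem_filter, Finset.mem_product, Finset.mem_Icc]
  constructor
  · rintro ⟨⟨-, ⟨h1, -⟩, h2, -⟩, h3⟩
    exact ⟨by omega, by omega, h3⟩
  · rintro ⟨h1, h2, h3⟩
    have h4 : 0 < d * e := mul_pos h1 h2
    refine ⟨⟨⟨?_, ?_⟩, ⟨by omega, ?_⟩, by omega, ?_⟩, h3⟩ <;> nlinarith [sq_nonneg u]

theorem sum_liouvilleTriples (n : ℤ) (g : ℤ → ℤ → ℤ → ℤ) :
    ∑ p ∈ liouvilleTriples n, g p.1 p.2.1 p.2.2 =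
      ∑ u ∈ Finset.Icc (-n) n, ∑ q ∈ factorPairs (n - u ^ 2), g u q.1 q.2 := by
  rw [Finset.sum_finset_product (liouvilleTriples n) (Finset.Icc (-n) n)
    fun u => factorPairs (n - u ^ 2)]
  rintro ⟨u, d, e⟩
  rw [mem_liouvilleTriples, mem_factorPairs]
  constructor
  · rintro ⟨h1, h2, h3⟩
    have := mul_pos h1 h2
    exact ⟨mem_Icc_of_sq_le (by linarith), h1, h2, by linarith⟩
  · rintro ⟨-, h1, h2, h3⟩
    exact ⟨h1, h2, by linarith⟩

theorem sum_factorPairs (n : ℕ) (f : ℤ → ℤ → ℤ) :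
    ∑ q ∈ factorPairs n, f q.1 q.2 = ∑ p ∈ n.divisorsAntidiagonal, f p.1 p.2 := by
  refine Finset.sum_nbij' (fun q => (q.1.toNat, q.2.toNat)) (fun p => ((p.1 : ℤ), (p.2 : ℤ)))
    ?_ ?_ ?_ ?_ ?_
  · rintro ⟨d, e⟩ h
    obtain ⟨h1, h2, h3⟩ := mem_factorPairs.1 h
    lift d to ℕ using h1.le
    lift e to ℕ using h2.le
    rw [Nat.mem_divisorsAntidiagonal]
    norm_cast at h1 h2 h3
    simp only [Int.toNat_natCast]
    exact ⟨h3, h3 ▸ (Nat.mul_pos h1 h2).ne'⟩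
  · rintro ⟨d, e⟩ h
    obtain ⟨h1, h2⟩ := Nat.mem_divisorsAntidiagonal.1 h
    simp only at h1
    rw [← h1] at h2
    rw [mem_factorPairs]
    norm_cast
    exact ⟨Nat.pos_of_ne_zero (left_ne_zero_of_mul h2),
      Nat.pos_of_ne_zero (right_ne_zero_of_mul h2), h1⟩
  · rintro ⟨d, e⟩ h
    obtain ⟨h1, h2, h3⟩ := mem_factorPairs.1 h
    simp [h1.le, h2.le]
  · rintro ⟨d, e⟩ h
    simp
  · rintro ⟨d, e⟩ h
    obtain ⟨h1, h2, h3⟩ := mem_factorPairs.1 h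
    simp [h1.le, h2.le]

/-! ### Symmetries of the set of triples -/

section Symmetry

variable {n : ℤ} (g h : ℤ → ℤ → ℤ → ℤ)

theorem sum_liouvilleTriples_neg :
    ∑ p ∈ liouvilleTriples n, g (-p.1) p.2.1 p.2.2 =
      ∑ p ∈ liouvilleTriples n, g p.1 p.2.1 p.2.2 := by
  refine Finset.sum_nbij' (fun p => (-p.1, p.2.1, p.2.2)) (fun p => (-p.1, p.2.1, p.2.2))
    ?_ ?_ ?_ ?_ ?_
  · rintro ⟨u, d, e⟩ hp
    simpa [mem_liouvilleTriples] using hp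
  · rintro ⟨u, d, e⟩ hp
    simpa [mem_liouvilleTriples] using hp
  all_goals simp

theorem sum_liouvilleTriples_swap :
    ∑ p ∈ liouvilleTriples n, g p.1 p.2.2 p.2.1 =
      ∑ p ∈ liouvilleTriples n, g p.1 p.2.1 p.2.2 := by
  refine Finset.sum_nbij' (fun p => (p.1, p.2.2, p.2.1)) (fun p => (p.1, p.2.2, p.2.1))
    ?_ ?_ ?_ ?_ ?_
  · rintro ⟨u, d, e⟩ hp
    rw [mem_liouvilleTriples] at hp ⊢
    exact ⟨hp.2.1, hp.1, by linarith [hp.2.2]⟩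
  · rintro ⟨u, d, e⟩ hp
    rw [mem_liouvilleTriples] at hp ⊢
    exact ⟨hp.2.1, hp.1, by linarith [hp.2.2]⟩
  all_goals simp

/-- The sum of `g` over its orbit under the symmetries `u ↦ -u` and `d ↔ e` of the set of
triples. -/
def orbitSum (u d e : ℤ) : ℤ := g u d e + g (-u) d e + g u e d + g (-u) e d

theorem orbitSum_swap (u d e : ℤ) : orbitSum g u d e = orbitSum g u e d := by
  simp only [orbitSum]
  ring

/-- Two functions have the same sum over the triples as soon as they agree after averaging over
`u ↦ -u` and `d ↔ e`. -/
theorem sum_liouvilleTriples_congr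
    (H : ∀ u d e, 0 < d → 0 < e → u ^ 2 + d * e = n → orbitSum g u d e = orbitSum h u d e) :
    ∑ p ∈ liouvilleTriples n, g p.1 p.2.1 p.2.2 =
      ∑ p ∈ liouvilleTriples n, h p.1 p.2.1 p.2.2 := by
  have key : ∀ f : ℤ → ℤ → ℤ → ℤ, ∑ p ∈ liouvilleTriples n, orbitSum f p.1 p.2.1 p.2.2 =
      4 * ∑ p ∈ liouvilleTriples n, f p.1 p.2.1 p.2.2 := fun f => by
    simp only [orbitSum, Finset.sum_add_distrib]
    rw [sum_liouvilleTriples_neg f, sum_liouvilleTriples_swap f,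
      sum_liouvilleTriples_swap fun u d e => f (-u) d e, sum_liouvilleTriples_neg f]
    ring
  have h1 : ∑ p ∈ liouvilleTriples n, orbitSum g p.1 p.2.1 p.2.2 =
      ∑ p ∈ liouvilleTriples n, orbitSum h p.1 p.2.1 p.2.2 := by
    refine Finset.sum_congr rfl ?_
    rintro ⟨u, d, e⟩ hp
    obtain ⟨h1, h2, h3⟩ := mem_liouvilleTriples.1 hp
    exact H u d e h1 h2 h3
  rw [key, key] at h1
  linarith

end Symmetry

/-! ### Liouville's identity -/

/-- The summand of Liouville's identity for the function `F`. -/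
def liouvilleTerm (F : ℤ → ℤ → ℤ → ℤ) (u d e : ℤ) : ℤ :=
  2 * F (e - 2 * u) (u + d) (2 * u + 2 * d - e) - F (d + e) u (d - e)

section Liouville

variable {F : ℤ → ℤ → ℤ → ℤ}

/-- Where `w = e - 2 u - d` is negative, `(u, d, e) ↦ (u + d + w, -w, e)` is an involution which
changes only the sign of the first argument of `F`. -/
theorem sum_liouvilleTriples_filter_lt (hodd : ∀ x y z, F (-x) y z = -F x y z) (n : ℤ) :
    ∑ p ∈ (liouvilleTriples n).filter (fun p => p.2.2 < 2 * p.1 + p.2.1),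
      F (p.2.2 - 2 * p.1) (p.1 + p.2.1) (2 * p.1 + 2 * p.2.1 - p.2.2) = 0 := by
  have h : ∑ p ∈ (liouvilleTriples n).filter (fun p => p.2.2 < 2 * p.1 + p.2.1),
      F (p.2.2 - 2 * p.1) (p.1 + p.2.1) (2 * p.1 + 2 * p.2.1 - p.2.2) =
      ∑ p ∈ (liouvilleTriples n).filter (fun p => p.2.2 < 2 * p.1 + p.2.1),
      -F (p.2.2 - 2 * p.1) (p.1 + p.2.1) (2 * p.1 + 2 * p.2.1 - p.2.2) := by
    have hmem : ∀ p ∈ (liouvilleTriples n).filter (fun p => p.2.2 < 2 * p.1 + p.2.1),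
        ((p.2.2 - p.1, 2 * p.1 + p.2.1 - p.2.2, p.2.2) : ℤ × ℤ × ℤ) ∈
          (liouvilleTriples n).filter (fun p => p.2.2 < 2 * p.1 + p.2.1) := by
      rintro ⟨u, d, e⟩ hp
      simp only [Finset.mem_filter, mem_liouvilleTriples] at hp ⊢
      obtain ⟨⟨h1, h2, h3⟩, h4⟩ := hp
      exact ⟨⟨by omega, h2, by linear_combination h3⟩, by omega⟩
    refine Finset.sum_nbij' (fun p => (p.2.2 - p.1, 2 * p.1 + p.2.1 - p.2.2, p.2.2))
      (fun p => (p.2.2 - p.1, 2 * p.1 + p.2.1 - p.2.2, p.2.2)) hmem hmem ?_ ?_ ?_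
    · rintro ⟨u, d, e⟩ -
      ext <;> simp only <;> ring
    · rintro ⟨u, d, e⟩ -
      ext <;> simp only <;> ring
    · rintro ⟨u, d, e⟩ -
      simp only
      rw [← hodd]
      congr 1 <;> ring
  rw [Finset.sum_neg_distrib] at h
  omega

/-- Where `w = e - 2 u - d` is positive, the change of variables `(u, d, e) ↦ (u + d, d, w)` leads
to one half, up to the boundary, of the sum on the other side of Liouville's identity. -/
theorem sum_liouvilleTriples_filter_gt (n : ℤ) :
    ∑ p ∈ (liouvilleTriples n).filter (fun p => 2 * p.1 + p.2.1 < p.2.2),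
      F (p.2.2 - 2 * p.1) (p.1 + p.2.1) (2 * p.1 + 2 * p.2.1 - p.2.2) =
    ∑ p ∈ (liouvilleTriples n).filter (fun p => p.2.1 - 2 * p.1 < p.2.2),
      F (p.2.1 + p.2.2) p.1 (p.2.1 - p.2.2) := by
  refine Finset.sum_nbij' (fun p => (p.1 + p.2.1, p.2.1, p.2.2 - 2 * p.1 - p.2.1))
    (fun p => (p.1 - p.2.1, p.2.1, p.2.2 + 2 * p.1 - p.2.1)) ?_ ?_ ?_ ?_ ?_
  · rintro ⟨u, d, e⟩ hp
    simp only [Finset.mem_filter, mem_liouvilleTriples] at hp ⊢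
    obtain ⟨⟨h1, h2, h3⟩, h4⟩ := hp
    exact ⟨⟨h1, by omega, by linear_combination h3⟩, by omega⟩
  · rintro ⟨u, d, e⟩ hp
    simp only [Finset.mem_filter, mem_liouvilleTriples] at hp ⊢
    obtain ⟨⟨h1, h2, h3⟩, h4⟩ := hp
    exact ⟨⟨h1, by omega, by linear_combination h3⟩, by omega⟩
  · rintro ⟨u, d, e⟩ -
    ext <;> simp only <;> ring
  · rintro ⟨u, d, e⟩ -
    ext <;> simp only <;> ring
  · rintro ⟨u, d, e⟩ -
    simp only
    congr 1 <;> ring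

/-- The symmetry `(u, d, e) ↦ (-u, e, d)` exchanges the triples with `d - 2 u < e` and those with
`e < d - 2 u`, and it preserves the summand. -/
theorem two_mul_sum_liouvilleTriples_filter (heven : ∀ x y z, F x (-y) (-z) = F x y z) (n : ℤ) :
    2 * ∑ p ∈ (liouvilleTriples n).filter (fun p => p.2.1 - 2 * p.1 < p.2.2),
      F (p.2.1 + p.2.2) p.1 (p.2.1 - p.2.2) =
    ∑ p ∈ liouvilleTriples n, F (p.2.1 + p.2.2) p.1 (p.2.1 - p.2.2) -
      ∑ p ∈ (liouvilleTriples n).filter (fun p => p.2.2 = 2 * p.1 + p.2.1),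
        F (p.2.1 + p.2.2) p.1 (p.2.2 - p.2.1) := by
  have hlt : ∑ p ∈ (liouvilleTriples n).filter (fun p => p.2.1 - 2 * p.1 < p.2.2),
      F (p.2.1 + p.2.2) p.1 (p.2.1 - p.2.2) =
      ∑ p ∈ (liouvilleTriples n).filter (fun p => p.2.2 < p.2.1 - 2 * p.1),
      F (p.2.1 + p.2.2) p.1 (p.2.1 - p.2.2) := by
    refine Finset.sum_nbij' (fun p => (-p.1, p.2.2, p.2.1)) (fun p => (-p.1, p.2.2, p.2.1))
      ?_ ?_ (by simp) (by simp) ?_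
    · rintro ⟨u, d, e⟩ hp
      simp only [Finset.mem_filter, mem_liouvilleTriples] at hp ⊢
      obtain ⟨⟨h1, h2, h3⟩, h4⟩ := hp
      exact ⟨⟨h2, h1, by linear_combination h3⟩, by omega⟩
    · rintro ⟨u, d, e⟩ hp
      simp only [Finset.mem_filter, mem_liouvilleTriples] at hp ⊢
      obtain ⟨⟨h1, h2, h3⟩, h4⟩ := hp
      exact ⟨⟨h2, h1, by linear_combination h3⟩, by omega⟩
    · rintro ⟨u, d, e⟩ -
      simp only
      rw [← heven]
      congr 1 <;> ring
  have heq : ∑ p ∈ (liouvilleTriples n).filter (fun p => p.2.2 = 2 * p.1 + p.2.1),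
      F (p.2.1 + p.2.2) p.1 (p.2.2 - p.2.1) =
      ∑ p ∈ (liouvilleTriples n).filter (fun p => p.2.2 = p.2.1 - 2 * p.1),
      F (p.2.1 + p.2.2) p.1 (p.2.1 - p.2.2) := by
    refine Finset.sum_nbij' (fun p => (p.1, p.2.2, p.2.1)) (fun p => (p.1, p.2.2, p.2.1))
      ?_ ?_ (by simp) (by simp) ?_
    · rintro ⟨u, d, e⟩ hp
      simp only [Finset.mem_filter, mem_liouvilleTriples] at hp ⊢
      obtain ⟨⟨h1, h2, h3⟩, h4⟩ := hp
      exact ⟨⟨h2, h1, by linear_combination h3⟩, by omega⟩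
    · rintro ⟨u, d, e⟩ hp
      simp only [Finset.mem_filter, mem_liouvilleTriples] at hp ⊢
      obtain ⟨⟨h1, h2, h3⟩, h4⟩ := hp
      exact ⟨⟨h2, h1, by linear_combination h3⟩, by omega⟩
    · rintro ⟨u, d, e⟩ -
      simp only
      rw [add_comm]
  have hsplit : ∑ p ∈ liouvilleTriples n, F (p.2.1 + p.2.2) p.1 (p.2.1 - p.2.2) =
      ∑ p ∈ (liouvilleTriples n).filter (fun p => p.2.1 - 2 * p.1 < p.2.2),
        F (p.2.1 + p.2.2) p.1 (p.2.1 - p.2.2) +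
      (∑ p ∈ (liouvilleTriples n).filter (fun p => p.2.2 = p.2.1 - 2 * p.1),
        F (p.2.1 + p.2.2) p.1 (p.2.1 - p.2.2) +
      ∑ p ∈ (liouvilleTriples n).filter (fun p => p.2.2 < p.2.1 - 2 * p.1),
        F (p.2.1 + p.2.2) p.1 (p.2.1 - p.2.2)) := by
    simp only [Finset.sum_filter, ← Finset.sum_add_distrib]
    refine Finset.sum_congr rfl fun p _ => ?_
    rcases lt_trichotomy (p.2.1 - 2 * p.1) p.2.2 with h | h | h
    · simp [h, h.ne', h.not_gt]
    · simp [h]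
    · simp [h, h.ne, h.not_gt]
  linarith

/-- Liouville's identity, with the boundary terms as sums over the triples with `e = 2 u + d`. -/
theorem sum_liouvilleTerm (hodd : ∀ x y z, F (-x) y z = -F x y z)
    (heven : ∀ x y z, F x (-y) (-z) = F x y z) (n : ℤ) :
    ∑ p ∈ liouvilleTriples n, liouvilleTerm F p.1 p.2.1 p.2.2 =
      ∑ p ∈ (liouvilleTriples n).filter (fun p => p.2.2 = 2 * p.1 + p.2.1),
        (2 * F p.2.1 (p.1 + p.2.1) p.2.1 - F (p.2.1 + p.2.2) p.1 (p.2.2 - p.2.1)) := by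
  have hsplit : ∑ p ∈ liouvilleTriples n,
        F (p.2.2 - 2 * p.1) (p.1 + p.2.1) (2 * p.1 + 2 * p.2.1 - p.2.2) =
      ∑ p ∈ (liouvilleTriples n).filter (fun p => 2 * p.1 + p.2.1 < p.2.2),
        F (p.2.2 - 2 * p.1) (p.1 + p.2.1) (2 * p.1 + 2 * p.2.1 - p.2.2) +
      (∑ p ∈ (liouvilleTriples n).filter (fun p => p.2.2 = 2 * p.1 + p.2.1),
        F p.2.1 (p.1 + p.2.1) p.2.1 +
      ∑ p ∈ (liouvilleTriples n).filter (fun p => p.2.2 < 2 * p.1 + p.2.1),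
        F (p.2.2 - 2 * p.1) (p.1 + p.2.1) (2 * p.1 + 2 * p.2.1 - p.2.2)) := by
    simp only [Finset.sum_filter, ← Finset.sum_add_distrib]
    refine Finset.sum_congr rfl fun p _ => ?_
    rcases lt_trichotomy (2 * p.1 + p.2.1) p.2.2 with h | h | h
    · simp [h, h.ne', h.not_gt]
    · rw [if_neg (by omega), if_pos h.symm, if_neg (by omega), ← h]
      ring_nf
    · simp [h, h.ne, h.not_gt]
  rw [sum_liouvilleTriples_filter_lt hodd, sum_liouvilleTriples_filter_gt] at hsplit
  have h2 := two_mul_sum_liouvilleTriples_filter heven n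
  simp only [liouvilleTerm, Finset.sum_sub_distrib, ← Finset.mul_sum]
  linarith

theorem sum_liouvilleTerm_of_not_isSquare (hodd : ∀ x y z, F (-x) y z = -F x y z)
    (heven : ∀ x y z, F x (-y) (-z) = F x y z) {n : ℤ} (hn : ¬ IsSquare n) :
    ∑ p ∈ liouvilleTriples n, liouvilleTerm F p.1 p.2.1 p.2.2 = 0 := by
  rw [sum_liouvilleTerm hodd heven, Finset.filter_false_of_mem, Finset.sum_empty]
  rintro ⟨u, d, e⟩ hp he
  obtain ⟨h1, h2, h3⟩ := mem_liouvilleTriples.1 hp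
  simp only at he
  exact hn ⟨u + d, by rw [← h3, he]; ring⟩

theorem sum_liouvilleTerm_sq (hodd : ∀ x y z, F (-x) y z = -F x y z)
    (heven : ∀ x y z, F x (-y) (-z) = F x y z) (m : ℕ) :
    ∑ p ∈ liouvilleTriples ((m + 1) ^ 2), liouvilleTerm F p.1 p.2.1 p.2.2 =
      ∑ i ∈ Finset.range (2 * m + 1),
        (2 * F (i + 1) (m + 1) (i + 1) - F (2 * (m + 1)) (m - i) (2 * (m - i))) := by
  rw [sum_liouvilleTerm hodd heven]
  refine Finset.sum_nbij' (fun p => (p.2.1 - 1).toNat)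
    (fun i => ((m : ℤ) - i, (i : ℤ) + 1, 2 * (m : ℤ) + 1 - i)) ?_ ?_ ?_ ?_ ?_
  · rintro ⟨u, d, e⟩ hp
    simp only [Finset.mem_filter, mem_liouvilleTriples] at hp
    obtain ⟨⟨h1, h2, h3⟩, h4⟩ := hp
    have h5 : u + d = m + 1 := by
      have : (u + d) ^ 2 = ((m : ℤ) + 1) ^ 2 := by rw [← h3, h4]; ring
      rcases sq_eq_sq_iff_eq_or_eq_neg.1 this with h | h <;> omega
    rw [Finset.mem_range]
    simp only
    omega
  · intro i hi
    rw [Finset.mem_range] at hi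
    simp only [Finset.mem_filter, mem_liouvilleTriples]
    exact ⟨⟨by omega, by omega, by ring⟩, by ring⟩
  · rintro ⟨u, d, e⟩ hp
    simp only [Finset.mem_filter, mem_liouvilleTriples] at hp
    obtain ⟨⟨h1, h2, h3⟩, h4⟩ := hp
    have h5 : u + d = m + 1 := by
      have : (u + d) ^ 2 = ((m : ℤ) + 1) ^ 2 := by rw [← h3, h4]; ring
      rcases sq_eq_sq_iff_eq_or_eq_neg.1 this with h | h <;> omega
    simp only [Prod.mk.injEq]
    omega
  · intro i _
    simp
  · rintro ⟨u, d, e⟩ hp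
    simp only [Finset.mem_filter, mem_liouvilleTriples] at hp
    obtain ⟨⟨h1, h2, h3⟩, h4⟩ := hp
    have h5 : u + d = m + 1 := by
      have : (u + d) ^ 2 = ((m : ℤ) + 1) ^ 2 := by rw [← h3, h4]; ring
      rcases sq_eq_sq_iff_eq_or_eq_neg.1 this with h | h <;> omega
    have h6 : ((d - 1).toNat : ℤ) = d - 1 := Int.toNat_of_nonneg (by omega)
    simp only [h6]
    obtain rfl : u = m + 1 - d := by omega
    subst h4
    rw [show (m : ℤ) + 1 - d + d = m + 1 by ring, show d - 1 + 1 = d by ring,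
      show d + (2 * ((m : ℤ) + 1 - d) + d) = 2 * (m + 1) by ring,
      show (m : ℤ) - (d - 1) = m + 1 - d by ring, add_sub_cancel_right]

end Liouville

/-! ### Solving the recursion by divisor sums -/

/-- If the weighted divisor sum `∑ w d e` over `d * e = n` satisfies, up to the factor `K`, the
recursion coming from `sum_mul_card_sqTuples_eq_zero`, it counts representations as `k` squares. -/
theorem mul_card_sqTuples_eq_sum {k : ℕ} {K : ℤ} {w : ℤ → ℤ → ℤ}
    (hnsq : ∀ n : ℤ, ¬ IsSquare n →
      ∑ p ∈ liouvilleTriples n, (p.2.1 * p.2.2 - k * p.1 ^ 2) * w p.2.1 p.2.2 = 0)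
    (hsq : ∀ m : ℕ, ∑ p ∈ liouvilleTriples ((m + 1) ^ 2),
      (p.2.1 * p.2.2 - k * p.1 ^ 2) * w p.2.1 p.2.2 = K * (2 * k * (m + 1) ^ 2))
    {n : ℤ} (hn : 0 < n) :
    K * (sqTuples (fun _ => True) k n).card = ∑ q ∈ factorPairs n, w q.1 q.2 := by
  induction n using Int.strongRec (m := 1) with
  | lt n h => omega
  | ge n h1 ih =>
  set r : ℤ → ℤ := fun n => (sqTuples (fun _ => True) k n).card with hr
  set W : ℤ → ℤ := fun n => ∑ q ∈ factorPairs n, w q.1 q.2 with hW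
  have hrec := sum_mul_card_sqTuples_eq_zero (fun _ => True) k n
  rw [Finset.filter_true] at hrec
  have hS : ∑ p ∈ liouvilleTriples n, (p.2.1 * p.2.2 - k * p.1 ^ 2) * w p.2.1 p.2.2 =
      ∑ u ∈ Finset.Icc (-n) n, (n - (k + 1) * u ^ 2) * W (n - u ^ 2) := by
    rw [sum_liouvilleTriples n fun u d e => (d * e - k * u ^ 2) * w d e]
    refine Finset.sum_congr rfl fun u _ => ?_
    rw [hW, Finset.mul_sum]
    refine Finset.sum_congr rfl ?_
    rintro ⟨d, e⟩ hq
    have := (mem_factorPairs.1 hq).2.2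
    simp only [this]
    ring
  have hdiff : ∑ u ∈ Finset.Icc (-n) n,
      (n - (k + 1) * u ^ 2) * (K * r (n - u ^ 2) - W (n - u ^ 2)) =
      -∑ p ∈ liouvilleTriples n, (p.2.1 * p.2.2 - k * p.1 ^ 2) * w p.2.1 p.2.2 := by
    rw [hS, ← sub_eq_zero, ← mul_zero K, ← hrec, Finset.mul_sum, ← Finset.sum_neg_distrib,
      ← Finset.sum_sub_distrib]
    refine Finset.sum_congr rfl fun u _ => ?_
    rw [hr]
    ring
  -- By induction the difference vanishes at `n - u ^ 2`, unless `u = 0` or `n - u ^ 2 = 0`. At `0`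
  -- it is `K`, because the zero tuple is counted and there are no factorizations of `0`.
  have hzero : ∀ u, u ≠ 0 → u ^ 2 ≠ n →
      (n - (k + 1) * u ^ 2) * (K * r (n - u ^ 2) - W (n - u ^ 2)) = 0 := by
    intro u hu hun
    have hu2 : 0 < u ^ 2 := sq_pos_of_ne_zero hu
    rcases lt_or_gt_of_ne hun with h | h
    · have h3 := ih (n - u ^ 2) (by omega) (by omega)
      rw [hr, hW]
      simp only
      rw [h3, sub_self, mul_zero]
    · rw [hr, hW]
      simp only
      rw [sqTuples_eq_empty_of_neg (by omega), factorPairs_of_nonpos (by omega)]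
      simp
  suffices n * (K * r n - W n) = 0 by
    rcases mul_eq_zero.1 this with h | h
    · omega
    · exact sub_eq_zero.1 h
  by_cases hs : IsSquare n
  · obtain ⟨l, hl⟩ : ∃ m : ℕ, n = (m + 1) ^ 2 := by
      obtain ⟨a, ha⟩ := hs
      have : a ≠ 0 := by rintro rfl; omega
      refine ⟨a.natAbs - 1, ?_⟩
      have h2 : ((a.natAbs - 1 : ℕ) : ℤ) + 1 = |a| := by rw [Int.abs_eq_natAbs]; omega
      rw [h2, sq_abs, ha, sq]
    rw [hl, hsq, ← hl] at hdiff
    have hr0 : r 0 = 1 := by rw [hr]; simp [card_sqTuples_zero]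
    have hW0 : W 0 = 0 := by rw [hW]; simp [factorPairs_of_nonpos]
    have h3 : ∑ u ∈ ({0, (l : ℤ) + 1, -((l : ℤ) + 1)} : Finset ℤ),
        (n - (k + 1) * u ^ 2) * (K * r (n - u ^ 2) - W (n - u ^ 2)) = -(K * (2 * k * n)) := by
      rw [← hdiff]
      refine Finset.sum_subset ?_ ?_
      · intro u hu
        simp only [Finset.mem_insert, Finset.mem_singleton] at hu
        refine mem_Icc_of_sq_le ?_
        rcases hu with rfl | rfl | rfl
        · simpa using hn.le
        · exact hl.ge
        · rw [neg_sq]; exact hl.ge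
      · intro u _ hu
        simp only [Finset.mem_insert, Finset.mem_singleton, not_or] at hu
        refine hzero u hu.1 fun h => ?_
        rw [hl] at h
        rcases sq_eq_sq_iff_eq_or_eq_neg.1 h with h | h
        · exact hu.2.1 h
        · exact hu.2.2 h
    rw [Finset.sum_insert, Finset.sum_insert, Finset.sum_singleton, neg_sq, ← hl] at h3
    · simp only [sub_self, hr0, hW0] at h3
      rw [zero_pow two_ne_zero, mul_zero, sub_zero] at h3
      linarith
    · simp only [Finset.mem_singleton]; omega
    · simp only [Finset.mem_insert, Finset.mem_singleton]; omega
  · rw [hnsq n hs, Finset.sum_eq_single_of_mem 0] at hdiff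
    · simpa using hdiff
    · exact Finset.mem_Icc.2 ⟨by omega, by omega⟩
    · intro u _ hu
      exact hzero u hu fun h => hs ⟨u, by rw [← h, sq]⟩

theorem sq_emod_eight_of_odd {v : ℤ} (hv : Odd v) : v ^ 2 % 8 = 1 := by
  obtain ⟨m, rfl⟩ := hv
  obtain ⟨c, hc⟩ := (Int.even_mul_succ_self m).two_dvd
  have : (2 * m + 1) ^ 2 = 8 * c + 1 := by linear_combination 4 * hc
  omega

/-- The analogue of `mul_card_sqTuples_eq_sum` for sums of `k` odd squares. Every such sum is
congruent to `k` modulo `8`, and the smallest one is `k` itself. -/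
theorem mul_card_sqTuples_odd_eq_sum {k : ℕ} {K : ℤ} {w : ℤ → ℤ → ℤ} (hk : k ≤ 8)
    (hbase : K * 2 ^ k = ∑ q ∈ factorPairs k, w q.1 q.2)
    (hrec : ∀ n : ℤ, n % 8 = (k + 1) % 8 → ∑ p ∈ liouvilleTriples n,
      p.1 % 2 * ((p.2.1 * p.2.2 - k * p.1 ^ 2) * w p.2.1 p.2.2) = 0)
    (n : ℤ) (hn : n % 8 = k % 8) :
    K * (sqTuples Odd k n).card = ∑ q ∈ factorPairs n, w q.1 q.2 := by
  induction n using Int.strongRec (m := k) with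
  | lt n h =>
    rw [card_sqTuples_odd_of_lt h, factorPairs_of_nonpos (by omega)]
    simp
  | ge n h1 ih =>
  rcases h1.eq_or_lt with rfl | h1
  · rw [card_sqTuples_odd_self, ← hbase]
    norm_num
  set r : ℤ → ℤ := fun n => (sqTuples Odd k n).card with hr
  set W : ℤ → ℤ := fun n => ∑ q ∈ factorPairs n, w q.1 q.2 with hW
  have hr' := sum_mul_card_sqTuples_eq_zero Odd k (n + 1)
  have hW' : ∑ u ∈ (Finset.Icc (-(n + 1)) (n + 1)).filter Odd,
      (n + 1 - (k + 1) * u ^ 2) * W (n + 1 - u ^ 2) = 0 := by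
    rw [← hrec (n + 1) (by omega), sum_liouvilleTriples (n + 1)
      fun u d e => u % 2 * ((d * e - k * u ^ 2) * w d e), Finset.sum_filter]
    refine Finset.sum_congr rfl fun u _ => ?_
    split_ifs with hu
    · rw [hW, Finset.mul_sum]
      refine Finset.sum_congr rfl ?_
      rintro ⟨d, e⟩ hq
      have := (mem_factorPairs.1 hq).2.2
      simp only [this, Int.odd_iff.1 hu]
      ring
    · rw [Int.not_odd_iff_even, Int.even_iff] at hu
      simp [hu]
  have hdiff : ∑ u ∈ (Finset.Icc (-(n + 1)) (n + 1)).filter Odd,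
      (n + 1 - (k + 1) * u ^ 2) * (K * r (n + 1 - u ^ 2) - W (n + 1 - u ^ 2)) = 0 := by
    have e : ∑ u ∈ (Finset.Icc (-(n + 1)) (n + 1)).filter Odd,
        (n + 1 - (k + 1) * u ^ 2) * (K * r (n + 1 - u ^ 2) - W (n + 1 - u ^ 2)) =
        K * ∑ u ∈ (Finset.Icc (-(n + 1)) (n + 1)).filter Odd,
          (n + 1 - (k + 1) * u ^ 2) * r (n + 1 - u ^ 2) -
        ∑ u ∈ (Finset.Icc (-(n + 1)) (n + 1)).filter Odd,
          (n + 1 - (k + 1) * u ^ 2) * W (n + 1 - u ^ 2) := by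
      rw [Finset.mul_sum, ← Finset.sum_sub_distrib]
      exact Finset.sum_congr rfl fun u _ => by ring
    rw [e, hW', sub_zero]
    exact mul_eq_zero_of_right K hr'
  -- The terms with `u ^ 2 > 1` vanish by induction, and `u = 1`, `u = -1` both lead to `n`.
  have h3 : ∑ u ∈ ({1, -1} : Finset ℤ),
      (n + 1 - (k + 1) * u ^ 2) * (K * r (n + 1 - u ^ 2) - W (n + 1 - u ^ 2)) = 0 := by
    rw [← hdiff]
    refine Finset.sum_subset ?_ ?_
    · intro u hu
      simp only [Finset.mem_insert, Finset.mem_singleton] at hu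
      rw [Finset.mem_filter, Finset.mem_Icc]
      rcases hu with rfl | rfl
      · exact ⟨⟨by omega, by omega⟩, odd_one⟩
      · exact ⟨⟨by omega, by omega⟩, odd_neg_one⟩
    · intro u hu hu'
      have hodd := (Finset.mem_filter.1 hu).2
      simp only [Finset.mem_insert, Finset.mem_singleton] at hu'
      have h4 : 1 < u ^ 2 := lt_of_le_of_ne (one_le_sq_of_odd hodd)
        fun h => hu' (sq_eq_one_iff.1 h.symm)
      have h5 : u ^ 2 % 8 = 1 := sq_emod_eight_of_odd hodd
      have h6 : K * r (n + 1 - u ^ 2) = W (n + 1 - u ^ 2) :=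
        ih (n + 1 - u ^ 2) (by omega) (by omega)
      rw [h6, sub_self, mul_zero]
  rw [Finset.sum_pair (by norm_num)] at h3
  have h4 : 2 * (n - k) * (K * r n - W n) = 0 := by
    have e1 : n + 1 - (-1 : ℤ) ^ 2 = n := by ring
    have e2 : n + 1 - (1 : ℤ) ^ 2 = n := by ring
    rw [e1, e2] at h3
    linear_combination h3
  rcases mul_eq_zero.1 h4 with h | h
  · omega
  · exact sub_eq_zero.1 h

/-- The sums over the triples required for `k` squares follow from Liouville's identity for `F` if
the summands agree after averaging over the symmetries, and if the boundary terms are as they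
should be. -/
theorem mul_card_sqTuples_eq_sum_of_liouville {k : ℕ} {K c : ℤ} {w : ℤ → ℤ → ℤ}
    {F : ℤ → ℤ → ℤ → ℤ} (hc : c ≠ 0) (hodd : ∀ x y z, F (-x) y z = -F x y z)
    (heven : ∀ x y z, F x (-y) (-z) = F x y z)
    (horb : ∀ u d e, orbitSum (liouvilleTerm F) u d e =
      orbitSum (fun u d e => c * ((d * e - k * u ^ 2) * w d e)) u d e)
    (hbdry : ∀ m : ℕ, ∑ i ∈ Finset.range (2 * m + 1),
        (2 * F (i + 1) (m + 1) (i + 1) - F (2 * (m + 1)) (m - i) (2 * (m - i))) =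
      c * (K * (2 * k * (m + 1) ^ 2)))
    {n : ℤ} (hn : 0 < n) :
    K * (sqTuples (fun _ => True) k n).card = ∑ q ∈ factorPairs n, w q.1 q.2 := by
  have key : ∀ n, c * ∑ p ∈ liouvilleTriples n, (p.2.1 * p.2.2 - k * p.1 ^ 2) * w p.2.1 p.2.2 =
      ∑ p ∈ liouvilleTriples n, liouvilleTerm F p.1 p.2.1 p.2.2 := fun n => by
    rw [sum_liouvilleTriples_congr _ _ fun u d e _ _ _ => horb u d e, Finset.mul_sum]
  refine mul_card_sqTuples_eq_sum (fun n hsq => ?_) (fun m => ?_) hn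
  · have h := key n
    rw [sum_liouvilleTerm_of_not_isSquare hodd heven hsq] at h
    exact (mul_eq_zero.1 h).resolve_left hc
  · have h := key ((m + 1) ^ 2)
    rw [sum_liouvilleTerm_sq hodd heven, hbdry] at h
    exact mul_left_cancel₀ hc h

/-- The analogue of `mul_card_sqTuples_eq_sum_of_liouville` for sums of odd squares. -/
theorem mul_card_sqTuples_odd_eq_sum_of_liouville {k : ℕ} {K c : ℤ} {w : ℤ → ℤ → ℤ}
    {F : ℤ → ℤ → ℤ → ℤ} (hk : k ≤ 8) (hc : c ≠ 0) (hodd : ∀ x y z, F (-x) y z = -F x y z)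
    (heven : ∀ x y z, F x (-y) (-z) = F x y z)
    (hbase : K * 2 ^ k = ∑ q ∈ factorPairs k, w q.1 q.2)
    (horb : ∀ u d e : ℤ, (u ^ 2 + d * e) % 8 = (k + 1) % 8 → orbitSum (liouvilleTerm F) u d e =
      orbitSum (fun u d e => c * (u % 2 * ((d * e - k * u ^ 2) * w d e))) u d e)
    (hbdry : ∀ m : ℕ, ((m : ℤ) + 1) ^ 2 % 8 = (k + 1) % 8 → ∑ i ∈ Finset.range (2 * m + 1),
      (2 * F (i + 1) (m + 1) (i + 1) - F (2 * (m + 1)) (m - i) (2 * (m - i))) = 0)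
    {n : ℤ} (hn : n % 8 = k % 8) :
    K * (sqTuples Odd k n).card = ∑ q ∈ factorPairs n, w q.1 q.2 := by
  refine mul_card_sqTuples_odd_eq_sum hk hbase (fun n h8 => ?_) n hn
  refine (mul_eq_zero.1 ?_).resolve_left hc
  rw [Finset.mul_sum, ← sum_liouvilleTriples_congr (liouvilleTerm F)
    (fun u d e => c * (u % 2 * ((d * e - k * u ^ 2) * w d e)))
    fun u d e _ _ h => horb u d e (by rw [h, h8])]
  by_cases hs : IsSquare n
  · obtain ⟨a, ha⟩ := hs
    rcases eq_or_ne a 0 with rfl | h0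
    · refine Finset.sum_eq_zero ?_
      rintro ⟨u, d, e⟩ hp
      obtain ⟨h1, h2, h3⟩ := mem_liouvilleTriples.1 hp
      have := mul_pos h1 h2
      nlinarith [sq_nonneg u]
    · have h2 : ((a.natAbs - 1 : ℕ) : ℤ) + 1 = |a| := by rw [Int.abs_eq_natAbs]; omega
      have h3 : n = (((a.natAbs - 1 : ℕ) : ℤ) + 1) ^ 2 := by rw [h2, sq_abs, ha, sq]
      rw [h3, sum_liouvilleTerm_sq hodd heven]
      exact hbdry _ (by rw [← h3, h8])
  · exact sum_liouvilleTerm_of_not_isSquare hodd heven hs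

/-! ### The character modulo four and the parity sign -/

/-- The nontrivial Dirichlet character modulo `4`, with integer values, as a function on `ℤ`. -/
def chi4 (a : ℤ) : ℤ := ZMod.χ₄ a

/-- The sign `(-1) ^ a` of an integer `a`. -/
def paritySign (a : ℤ) : ℤ := 1 - 2 * (a % 2)

section Characters

theorem chi4_eq (a : ℤ) : chi4 a = if a % 2 = 0 then 0 else if a % 4 = 1 then 1 else -1 :=
  ZMod.χ₄_int_eq_if_mod_four a

theorem chi4_neg (a : ℤ) : chi4 (-a) = -chi4 a := by
  rw [chi4_eq, chi4_eq]; split_ifs <;> omega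

theorem chi4_mul (a b : ℤ) : chi4 (a * b) = chi4 a * chi4 b := by
  rw [chi4, chi4, chi4, Int.cast_mul, map_mul]

theorem chi4_of_even {a : ℤ} (ha : a % 2 = 0) : chi4 a = 0 := by
  rw [chi4_eq, if_pos ha]

theorem chi4_add_of_mod_four_eq_two {a b : ℤ} (hb : b % 4 = 2) : chi4 (a + b) = -chi4 a := by
  rw [chi4_eq, chi4_eq]; split_ifs <;> omega

theorem chi4_sub_two_mul (a b : ℤ) : chi4 (a - 2 * b) = chi4 a * paritySign b := by
  rw [chi4_eq, chi4_eq, paritySign]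
  rcases Int.emod_two_eq_zero_or_one b with h | h <;> rw [h] <;> split_ifs <;> omega

theorem paritySign_neg (a : ℤ) : paritySign (-a) = paritySign a := by
  simp only [paritySign]; omega

theorem paritySign_add_one (a : ℤ) : paritySign (a + 1) = -paritySign a := by
  simp only [paritySign]; omega

theorem paritySign_add (a b : ℤ) : paritySign (a + b) = paritySign a * paritySign b := by
  simp only [paritySign]
  rcases Int.emod_two_eq_zero_or_one a with h | h <;>
    rcases Int.emod_two_eq_zero_or_one b with h' | h' <;> rw [h, h'] <;> omega

theorem paritySign_mul_self (a : ℤ) : paritySign a * paritySign a = 1 := by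
  simp only [paritySign]
  rcases Int.emod_two_eq_zero_or_one a with h | h <;> rw [h] <;> norm_num

theorem chi4_two_mul_add_one (a : ℤ) : chi4 (2 * a + 1) = paritySign a := by
  have := chi4_sub_two_mul 1 (-a)
  rw [paritySign_neg, show (1 : ℤ) - 2 * -a = 2 * a + 1 by ring] at this
  rw [this, chi4_eq]
  norm_num

end Characters

/-! ### Sums of squares -/

section Squares

/-- For `F x y z = (-1) ^ y χ₄(z) G x y` with `G` odd in `y`, the second term of Liouville's
identity cancels under `u ↦ -u`, and the signs in the first term combine to `-χ₄(e)`. -/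
theorem orbitSum_liouvilleTerm_chi4 {G : ℤ → ℤ → ℤ} (hG : ∀ x y, G x (-y) = -G x y) (u d e : ℤ) :
    orbitSum (liouvilleTerm fun x y z => paritySign y * chi4 z * G x y) u d e =
      orbitSum (fun u d e => -2 * chi4 e * G (e - 2 * u) (u + d)) u d e := by
  have h : ∀ u d e, paritySign (u + d) * chi4 (2 * u + 2 * d - e) = -chi4 e := fun u d e => by
    rw [show 2 * u + 2 * d - e = -(e - 2 * (u + d)) by ring, chi4_neg, chi4_sub_two_mul]
    linear_combination -chi4 e * paritySign_mul_self (u + d)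
  simp only [orbitSum, liouvilleTerm, h, hG, paritySign_neg]
  ring

theorem sum_chi4_mul (m : ℕ) :
    ∑ i ∈ Finset.range (2 * m + 1), chi4 (i + 1) * (i + 1) = paritySign m * (m + 1) := by
  induction m with
  | zero => simp [paritySign, chi4_eq]
  | succ m ih =>
    rw [show 2 * (m + 1) + 1 = 2 * m + 1 + 1 + 1 by ring, Finset.sum_range_succ,
      Finset.sum_range_succ, ih]
    push_cast
    rw [chi4_of_even (a := 2 * (m : ℤ) + 1 + 1) (by omega),
      show 2 * (m : ℤ) + 2 + 1 = 2 * (m + 1) + 1 by ring, chi4_two_mul_add_one,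
      paritySign_add_one]
    ring

theorem sum_chi4_mul_cube (m : ℕ) :
    ∑ i ∈ Finset.range (2 * m + 1), chi4 (i + 1) * (i + 1) ^ 3 =
      paritySign m * ((m + 1) * (4 * (m + 1) ^ 2 - 3)) := by
  induction m with
  | zero => simp [paritySign, chi4_eq]
  | succ m ih =>
    rw [show 2 * (m + 1) + 1 = 2 * m + 1 + 1 + 1 by ring, Finset.sum_range_succ,
      Finset.sum_range_succ, ih]
    push_cast
    rw [chi4_of_even (a := 2 * (m : ℤ) + 1 + 1) (by omega),
      show 2 * (m : ℤ) + 2 + 1 = 2 * (m + 1) + 1 by ring, chi4_two_mul_add_one,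
      paritySign_add_one]
    ring

/-- The boundary terms for `F x y z = (-1) ^ y χ₄(z) G x y`: the second one vanishes since its
last argument is even. -/
theorem sum_boundary_chi4 (G : ℤ → ℤ → ℤ) (m : ℕ) :
    ∑ i ∈ Finset.range (2 * m + 1),
      (2 * (paritySign (m + 1) * chi4 (i + 1) * G (i + 1) (m + 1)) -
        paritySign (m - i) * chi4 (2 * (m - i)) * G (2 * (m + 1)) (m - i)) =
    -2 * paritySign m * ∑ i ∈ Finset.range (2 * m + 1), chi4 (i + 1) * G (i + 1) (m + 1) := by
  rw [Finset.mul_sum]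
  refine Finset.sum_congr rfl fun i _ => ?_
  rw [chi4_of_even (a := 2 * ((m : ℤ) - i)) (by omega), paritySign_add_one]
  ring

theorem card_sqTuples_two {n : ℤ} (hn : 0 < n) :
    ((sqTuples (fun _ => True) 2 n).card : ℤ) = ∑ q ∈ factorPairs n, 4 * chi4 q.1 := by
  rw [← one_mul (Finset.card _ : ℤ)]
  refine mul_card_sqTuples_eq_sum_of_liouville (k := 2) (K := 1) (c := 1)
    (w := fun d _ => 4 * chi4 d)
    (F := fun x y z => paritySign y * chi4 z * (-2 * x * y)) one_ne_zero ?_ ?_ ?_ ?_ hn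
  · intro x y z; ring
  · intro x y z; rw [paritySign_neg, chi4_neg]; ring
  · intro u d e
    rw [orbitSum_liouvilleTerm_chi4 (G := fun x y => -2 * x * y) fun x y => by ring]
    simp only [orbitSum]
    push_cast
    ring
  · intro m
    rw [sum_boundary_chi4 fun x y => -2 * x * y]
    have h := sum_chi4_mul m
    have h2 : ∑ i ∈ Finset.range (2 * m + 1), chi4 (i + 1) * (-2 * (i + 1) * ((m : ℤ) + 1)) =
        -2 * (m + 1) * ∑ i ∈ Finset.range (2 * m + 1), chi4 (i + 1) * (i + 1) := by
      rw [Finset.mul_sum]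
      exact Finset.sum_congr rfl fun i _ => by ring
    rw [h2, h]
    push_cast
    linear_combination 4 * ((m : ℤ) + 1) ^ 2 * paritySign_mul_self m

theorem card_sqTuples_six {n : ℤ} (hn : 0 < n) :
    ((sqTuples (fun _ => True) 6 n).card : ℤ) =
      ∑ q ∈ factorPairs n, (16 * chi4 q.2 - 4 * chi4 q.1) * q.1 ^ 2 := by
  rw [← one_mul (Finset.card _ : ℤ)]
  refine mul_card_sqTuples_eq_sum_of_liouville (k := 6) (K := 1) (c := 1)
    (w := fun d e => (16 * chi4 e - 4 * chi4 d) * d ^ 2)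
    (F := fun x y z => paritySign y * chi4 z * (2 * x ^ 3 * y - 8 * x * y ^ 3)) one_ne_zero
    ?_ ?_ ?_ ?_ hn
  · intro x y z; ring
  · intro x y z; rw [paritySign_neg, chi4_neg]; ring
  · intro u d e
    rw [orbitSum_liouvilleTerm_chi4 (G := fun x y => 2 * x ^ 3 * y - 8 * x * y ^ 3)
      fun x y => by ring]
    simp only [orbitSum]
    push_cast
    ring
  · intro m
    rw [sum_boundary_chi4 fun x y => 2 * x ^ 3 * y - 8 * x * y ^ 3]
    have h2 : ∑ i ∈ Finset.range (2 * m + 1),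
        chi4 (i + 1) * (2 * (i + 1) ^ 3 * ((m : ℤ) + 1) - 8 * (i + 1) * ((m : ℤ) + 1) ^ 3) =
        2 * (m + 1) * ∑ i ∈ Finset.range (2 * m + 1), chi4 (i + 1) * (i + 1) ^ 3 -
        8 * (m + 1) ^ 3 * ∑ i ∈ Finset.range (2 * m + 1), chi4 (i + 1) * (i + 1) := by
      rw [Finset.mul_sum, Finset.mul_sum, ← Finset.sum_sub_distrib]
      exact Finset.sum_congr rfl fun i _ => by ring
    rw [h2, sum_chi4_mul, sum_chi4_mul_cube]
    push_cast
    linear_combination 12 * ((m : ℤ) + 1) ^ 2 * paritySign_mul_self m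

theorem add_emod_two_eq (a b : ℤ) : (a + b) % 2 = a % 2 + b % 2 - 2 * (a % 2) * (b % 2) := by
  rcases Int.emod_two_eq_zero_or_one a with h | h <;>
    rcases Int.emod_two_eq_zero_or_one b with h' | h' <;> rw [h, h'] <;> omega

/-- The value, for `F x y z = (x mod 2) G x y z`, of the summand of Liouville's identity. -/
theorem liouvilleTerm_emod_two (G : ℤ → ℤ → ℤ → ℤ) (u d e : ℤ) :
    liouvilleTerm (fun x y z => x % 2 * G x y z) u d e =
      2 * (e % 2 * G (e - 2 * u) (u + d) (2 * u + 2 * d - e)) -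
        (d % 2 + e % 2 - 2 * (d % 2) * (e % 2)) * G (d + e) u (d - e) := by
  rw [liouvilleTerm, add_emod_two_eq, show (e - 2 * u) % 2 = e % 2 by omega]

/-- The boundary terms for `F x y z = (x mod 2) G x y z`: the second one vanishes since its first
argument is even. -/
theorem sum_boundary_emod_two (G : ℤ → ℤ → ℤ → ℤ) (m : ℕ) :
    ∑ i ∈ Finset.range (2 * m + 1),
      (2 * (((i : ℤ) + 1) % 2 * G (i + 1) (m + 1) (i + 1)) -
        2 * ((m : ℤ) + 1) % 2 * G (2 * (m + 1)) (m - i) (2 * (m - i))) =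
    2 * ∑ i ∈ Finset.range (2 * m + 1), ((i : ℤ) + 1) % 2 * G (i + 1) (m + 1) (i + 1) := by
  rw [Finset.mul_sum]
  refine Finset.sum_congr rfl fun i _ => ?_
  rw [Int.mul_emod_right, zero_mul, sub_zero]

theorem sum_odd_range (f : ℤ → ℤ) (m : ℕ) :
    ∑ i ∈ Finset.range (2 * m + 1), ((i : ℤ) + 1) % 2 * f (i + 1) =
      ∑ i ∈ Finset.range (m + 1), f (2 * i + 1) := by
  induction m with
  | zero => simp
  | succ m ih =>
    rw [show 2 * (m + 1) + 1 = 2 * m + 1 + 1 + 1 by ring, Finset.sum_range_succ,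
      Finset.sum_range_succ, ih, Finset.sum_range_succ _ (m + 1)]
    push_cast
    rw [show (2 * (m : ℤ) + 1 + 1) % 2 = 0 by omega,
      show (2 * (m : ℤ) + 2 + 1) % 2 = 1 by omega,
      show 2 * (m : ℤ) + 2 + 1 = 2 * (m + 1) + 1 by ring]
    ring

/-- Here `F` is `x (z ^ 2 - x ^ 2 + 16 y ^ 2 - 12 y z)` on odd `x`, and zero on even `x`. Its
coefficients solve the linear system which expresses that the summand of Liouville's identity agrees
with the weighted one after averaging. -/
theorem card_sqTuples_four {n : ℤ} (hn : 0 < n) :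
    ((sqTuples (fun _ => True) 4 n).card : ℤ) =
      ∑ q ∈ factorPairs n, 8 * ((3 - 2 * (q.2 % 2)) * (q.1 % 2) * q.1) := by
  rw [← one_mul (Finset.card _ : ℤ)]
  refine mul_card_sqTuples_eq_sum_of_liouville (k := 4) (K := 1) (c := 1)
    (w := fun d e => 8 * ((3 - 2 * (e % 2)) * (d % 2) * d))
    (F := fun x y z => x % 2 * (x * (z ^ 2 - x ^ 2 + 16 * y ^ 2 - 12 * y * z))) one_ne_zero
    ?_ ?_ ?_ ?_ hn
  · intro x y z
    rw [show -x % 2 = x % 2 by omega]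
    ring
  · intro x y z; ring
  · intro u d e
    simp only [orbitSum, liouvilleTerm_emod_two]
    push_cast
    ring
  · intro m
    rw [sum_boundary_emod_two fun x y z => x * (z ^ 2 - x ^ 2 + 16 * y ^ 2 - 12 * y * z),
      sum_odd_range fun x =>
        x * (x ^ 2 - x ^ 2 + 16 * ((m : ℤ) + 1) ^ 2 - 12 * ((m : ℤ) + 1) * x)]
    have h : ∀ (l : ℤ) (k : ℕ), ∑ i ∈ Finset.range k, (2 * (i : ℤ) + 1) *
        ((2 * (i : ℤ) + 1) ^ 2 - (2 * (i : ℤ) + 1) ^ 2 + 16 * l ^ 2 - 12 * l * (2 * i + 1)) =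
        16 * l ^ 2 * k ^ 2 - 4 * l * (k * (4 * k ^ 2 - 1)) := by
      intro l k
      induction k with
      | zero => simp
      | succ k ih => rw [Finset.sum_range_succ, ih]; push_cast; ring
    rw [h]
    push_cast
    ring

/-- The weights are the multiples `8`, `-15`, `7` and `0` of `16 d ^ 3 / 7` for `(d, e)`
even-odd, odd-even, odd-odd and even-even. -/
theorem seven_mul_card_sqTuples_eight {n : ℤ} (hn : 0 < n) :
    7 * ((sqTuples (fun _ => True) 8 n).card : ℤ) =
      ∑ q ∈ factorPairs n, 16 * ((8 * (q.2 % 2) - 15 * (q.1 % 2) + 14 * (q.1 % 2) * (q.2 % 2)) *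
        q.1 ^ 3) := by
  refine mul_card_sqTuples_eq_sum_of_liouville (k := 8) (K := 7) (c := 2)
    (w := fun d e => 16 * ((8 * (e % 2) - 15 * (d % 2) + 14 * (d % 2) * (e % 2)) * d ^ 3))
    (F := fun x y z => x % 2 * (x * (7 * x ^ 4 - 224 * x ^ 2 * y ^ 2 - 21 * z ^ 4 +
      14 * x ^ 2 * z ^ 2 - 672 * y ^ 2 * z ^ 2 + 216 * y * z ^ 3 + 768 * y ^ 3 * z +
      24 * x ^ 2 * y * z))) two_ne_zero ?_ ?_ ?_ ?_ hn
  · intro x y z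
    rw [show -x % 2 = x % 2 by omega]
    ring
  · intro x y z; ring
  · intro u d e
    simp only [orbitSum, liouvilleTerm_emod_two]
    push_cast
    ring
  · intro m
    rw [sum_boundary_emod_two fun x y z => x * (7 * x ^ 4 - 224 * x ^ 2 * y ^ 2 - 21 * z ^ 4 +
        14 * x ^ 2 * z ^ 2 - 672 * y ^ 2 * z ^ 2 + 216 * y * z ^ 3 + 768 * y ^ 3 * z +
        24 * x ^ 2 * y * z)]
    have h : ∀ (l : ℤ) (k : ℕ), ∑ i ∈ Finset.range k,
        (-896 * l ^ 2 * (2 * (i : ℤ) + 1) ^ 3 + 240 * l * (2 * i + 1) ^ 4 +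
          768 * l ^ 3 * (2 * i + 1) ^ 2) =
        -896 * l ^ 2 * (k ^ 2 * (2 * k ^ 2 - 1)) + 16 * l * (k * (48 * k ^ 4 - 40 * k ^ 2 + 7)) +
          256 * l ^ 3 * (k * (4 * k ^ 2 - 1)) := by
      intro l k
      induction k with
      | zero => simp
      | succ k ih => rw [Finset.sum_range_succ, ih]; push_cast; ring
    have h2 := sum_odd_range (fun x => -896 * ((m : ℤ) + 1) ^ 2 * x ^ 3 +
      240 * ((m : ℤ) + 1) * x ^ 4 + 768 * ((m : ℤ) + 1) ^ 3 * x ^ 2) m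
    rw [h] at h2
    rw [Finset.sum_congr rfl fun i _ => ?_, h2]
    · push_cast
      ring
    · ring

end Squares

/-! ### Sums of odd squares -/

section OddSquares

theorem sq_emod_four_of_even {u : ℤ} (hu : u % 2 = 0) : u ^ 2 % 4 = 0 := by
  obtain ⟨v, rfl⟩ := Int.dvd_of_emod_eq_zero hu
  rw [show (2 * v) ^ 2 = 4 * v ^ 2 by ring]
  omega

theorem emod_two_and_sq_emod (u : ℤ) :
    u % 2 = 0 ∧ u ^ 2 % 4 = 0 ∨ u % 2 = 1 ∧ u ^ 2 % 8 = 1 := by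
  rcases Int.emod_two_eq_zero_or_one u with h | h
  · exact .inl ⟨h, sq_emod_four_of_even h⟩
  · exact .inr ⟨h, sq_emod_eight_of_odd (Int.odd_iff.2 h)⟩

/-- The residue of `d * e` modulo `8` as a linear expression in `e`, for each residue of `d`. -/
theorem mul_emod_eight_cases (d e : ℤ) :
    d % 8 = 0 ∧ d * e % 8 = 0 ∨ d % 8 = 1 ∧ d * e % 8 = e % 8 ∨
    d % 8 = 2 ∧ d * e % 8 = 2 * e % 8 ∨ d % 8 = 3 ∧ d * e % 8 = 3 * e % 8 ∨
    d % 8 = 4 ∧ d * e % 8 = 4 * e % 8 ∨ d % 8 = 5 ∧ d * e % 8 = 5 * e % 8 ∨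
    d % 8 = 6 ∧ d * e % 8 = 6 * e % 8 ∨ d % 8 = 7 ∧ d * e % 8 = 7 * e % 8 := by
  have h1 : d * e % 8 = d % 8 * e % 8 := ((Int.mod_modEq d 8).mul_right e).symm
  have h3 : d % 8 = 0 ∨ d % 8 = 1 ∨ d % 8 = 2 ∨ d % 8 = 3 ∨ d % 8 = 4 ∨ d % 8 = 5 ∨ d % 8 = 6 ∨
    d % 8 = 7 := by omega
  rcases h3 with h3 | h3 | h3 | h3 | h3 | h3 | h3 | h3 <;> rw [h3] at h1 ⊢ <;> simp [h1]

/-- The residues of `d` and `e`, given those of `u ^ 2` and of `u ^ 2 + d * e` modulo `8`. -/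
theorem emod_of_sq_add_mul_emod_eight_eq_five {u d e : ℤ} (h : (u ^ 2 + d * e) % 8 = 5) :
    (u % 2 = 0 ∧ d % 2 = 1 ∧ e % 2 = 1 ∧ (d + e) % 4 = 2) ∨
      u % 2 = 1 ∧ (d % 2 = 1 ∧ e % 4 = 0 ∨ d % 4 = 0 ∧ e % 2 = 1 ∨ d % 4 = 2 ∧ e % 4 = 2) := by
  rcases mul_emod_eight_cases d e with h1 | h1 | h1 | h1 | h1 | h1 | h1 | h1 <;>
    rcases emod_two_and_sq_emod u with h2 | h2 <;> omega

theorem emod_of_sq_add_mul_emod_eight_eq_seven {u d e : ℤ} (h : (u ^ 2 + d * e) % 8 = 7) :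
    (u % 2 = 0 ∧ d % 2 = 1 ∧ e % 2 = 1 ∧ (d + e) % 4 = 0) ∨
      u % 2 = 1 ∧ (d % 2 = 1 ∧ e % 4 = 2 ∨ d % 4 = 2 ∧ e % 2 = 1) := by
  rcases mul_emod_eight_cases d e with h1 | h1 | h1 | h1 | h1 | h1 | h1 | h1 <;>
    rcases emod_two_and_sq_emod u with h2 | h2 <;> omega

theorem emod_of_sq_add_mul_emod_eight_eq_one {u d e : ℤ} (h : (u ^ 2 + d * e) % 8 = 1) :
    (u % 2 = 0 ∧ d % 2 = 1 ∧ e % 2 = 1) ∨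
      u % 2 = 1 ∧ (d % 2 = 1 ∧ e % 4 = 0 ∨ d % 4 = 0 ∧ e % 2 = 1 ∨ d % 4 = 0 ∧ e % 4 = 0 ∨
        d % 4 = 0 ∧ e % 4 = 2 ∨ d % 4 = 2 ∧ e % 4 = 0) := by
  rcases mul_emod_eight_cases d e with h1 | h1 | h1 | h1 | h1 | h1 | h1 | h1 <;>
    rcases emod_two_and_sq_emod u with h2 | h2 <;> omega

theorem sq_emod_eight (a : ℤ) : a ^ 2 % 8 = 0 ∨ a ^ 2 % 8 = 1 ∨ a ^ 2 % 8 = 4 := by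
  rcases emod_two_and_sq_emod a with h | h <;> omega

/-- Only the pairs of `d` and `e` congruent to `2` modulo `4` have nonzero weight; the function `F`
is `-4 x ^ 3` on the multiples of `4`. There are no boundary terms since no square is `5` modulo
`8`. -/
theorem card_sqTuples_odd_four {n : ℤ} (hn : n % 8 = 4) :
    ((sqTuples Odd 4 n).card : ℤ) =
      ∑ q ∈ factorPairs n, if q.1 % 4 = 2 ∧ q.2 % 4 = 2 then 8 * q.1 else 0 := by
  rw [← one_mul (Finset.card _ : ℤ)]
  obtain ⟨f, hf⟩ : ∃ f : ℤ → ℤ, ∀ x, f x = if x % 4 = 0 then -4 * x ^ 3 else 0 :=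
    ⟨_, fun _ => rfl⟩
  have hf0 : ∀ x, x % 4 = 0 → f x = -4 * x ^ 3 := fun x h => by rw [hf, if_pos h]
  have hf1 : ∀ x, x % 4 ≠ 0 → f x = 0 := fun x h => by rw [hf, if_neg h]
  refine mul_card_sqTuples_odd_eq_sum_of_liouville (k := 4) (K := 1) (c := 3)
    (F := fun x _ _ => f x) (w := fun d e => if d % 4 = 2 ∧ e % 4 = 2 then 8 * d else 0)
    (by norm_num) (by norm_num) ?_ (fun _ _ _ => rfl) ?_ ?_ ?_ hn
  · intro x _ _
    by_cases h : x % 4 = 0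
    · rw [hf0 _ h, hf0 _ (by omega)]; ring
    · rw [hf1 _ h, hf1 _ (by omega), neg_zero]
  · rw [sum_factorPairs 4 fun d e => if d % 4 = 2 ∧ e % 4 = 2 then 8 * d else 0]
    rfl
  · intro u d e h
    have h0 : (e - 2 * u) % 4 ≠ 0 → (d - 2 * u) % 4 ≠ 0 → (d + e) % 4 ≠ 0 →
        orbitSum (liouvilleTerm fun x _ _ => f x) u d e = 0 := fun h1 h2 h3 => by
      simp only [orbitSum, liouvilleTerm]
      rw [hf1 _ h1, hf1 _ h2, add_comm e d, hf1 _ h3, hf1 (e - 2 * -u) (by omega),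
        hf1 (d - 2 * -u) (by omega)]
      rfl
    rcases emod_of_sq_add_mul_emod_eight_eq_five h with
      ⟨h1, h2, h3, h4⟩ | ⟨h1, ⟨h2, h3⟩ | ⟨h2, h3⟩ | ⟨h2, h3⟩⟩
    · rw [h0 (by omega) (by omega) (by omega), orbitSum, h1, show -u % 2 = 0 by omega]
      ring
    · rw [h0 (by omega) (by omega) (by omega), orbitSum, if_neg (by omega), if_neg (by omega)]
      ring
    · rw [h0 (by omega) (by omega) (by omega), orbitSum, if_neg (by omega), if_neg (by omega)]
      ring
    · simp only [orbitSum, liouvilleTerm]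
      rw [hf0 (e - 2 * u) (by omega), hf0 (d + e) (by omega), hf0 (e - 2 * -u) (by omega),
        hf0 (d - 2 * u) (by omega), hf0 (e + d) (by omega), hf0 (d - 2 * -u) (by omega),
        if_pos ⟨h2, h3⟩, if_pos ⟨h3, h2⟩, h1, show -u % 2 = 1 by omega]
      push_cast
      ring
  · intro m h
    rcases sq_emod_eight ((m : ℤ) + 1) with h' | h' | h' <;> rw [h'] at h <;> norm_num at h

/-- There are no boundary terms since no square is `7` modulo `8`. -/
theorem card_sqTuples_odd_six {n : ℤ} (hn : n % 8 = 6) :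
    ((sqTuples Odd 6 n).card : ℤ) =
      ∑ q ∈ factorPairs n, (chi4 q.2 - 4 * chi4 q.1) * q.1 ^ 2 := by
  rw [← one_mul (Finset.card _ : ℤ)]
  refine mul_card_sqTuples_odd_eq_sum_of_liouville (k := 6) (K := 1) (c := 8)
    (F := fun x y z => chi4 x * (12 * x ^ 2 * y ^ 2 - x ^ 4 - 3 * x ^ 2 * z ^ 2 - 2 * y ^ 3 * z) +
      chi4 z * (10 * x * y ^ 3))
    (w := fun d e => (chi4 e - 4 * chi4 d) * d ^ 2)
    (by norm_num) (by norm_num) ?_ ?_ ?_ ?_ ?_ hn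
  · intro x y z; rw [chi4_neg]; ring
  · intro x y z; rw [chi4_neg]; ring
  · rw [sum_factorPairs 6 fun d e => (chi4 e - 4 * chi4 d) * d ^ 2,
      show Nat.divisorsAntidiagonal 6 = {(1, 6), (2, 3), (3, 2), (6, 1)} from rfl]
    simp [chi4_eq]
  · intro u d e h
    have hz : ∀ u d e, chi4 (2 * u + 2 * d - e) = -(chi4 e * (paritySign u * paritySign d)) :=
      fun u d e => by
        rw [show 2 * u + 2 * d - e = -(e - 2 * (u + d)) by ring, chi4_neg, chi4_sub_two_mul,
          paritySign_add]
    have hs0 : ∀ {a : ℤ}, a % 2 = 0 → paritySign a = 1 := fun h => by rw [paritySign, h]; rfl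
    have hs1 : ∀ {a : ℤ}, a % 2 = 1 → paritySign a = -1 := fun h => by rw [paritySign, h]; rfl
    simp only [orbitSum, liouvilleTerm, hz, chi4_sub_two_mul, paritySign_neg]
    rcases emod_of_sq_add_mul_emod_eight_eq_seven h with
      ⟨h1, h2, h3, h4⟩ | ⟨h1, ⟨h2, h3⟩ | ⟨h2, h3⟩⟩
    -- Here `d * e` is `3` modulo `4`, and the first terms of Liouville's identity cancel in pairs.
    · have h5 : chi4 e = -chi4 d := by
        rw [chi4_eq, chi4_eq]; split_ifs <;> omega
      rw [h5, chi4_of_even (a := d + e) (by omega), chi4_of_even (a := e + d) (by omega),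
        chi4_of_even (a := d - e) (by omega), chi4_of_even (a := e - d) (by omega), hs0 h1,
        hs1 h2, hs1 h3, h1, show -u % 2 = 0 by omega]
      ring
    · rw [add_comm e d, ← neg_sub d e, chi4_neg, sub_eq_add_neg d e,
        chi4_add_of_mod_four_eq_two h3, chi4_add_of_mod_four_eq_two (b := -e) (by omega),
        chi4_of_even (a := e) (by omega), hs1 h1, hs1 h2, hs0 (a := e) (by omega), h1,
        show -u % 2 = 1 by omega]
      push_cast
      ring
    · rw [add_comm d e, ← neg_sub e d, chi4_neg, sub_eq_add_neg e d,
        chi4_add_of_mod_four_eq_two h2, chi4_add_of_mod_four_eq_two (b := -d) (by omega),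
        chi4_of_even (a := d) (by omega), hs1 h1, hs1 h3, hs0 (a := d) (by omega), h1,
        show -u % 2 = 1 by omega]
      push_cast
      ring
  · intro m h
    rcases sq_emod_eight ((m : ℤ) + 1) with h' | h' | h' <;> rw [h'] at h <;> norm_num at h

/-- The function to which Liouville's identity is applied for eight odd squares. It is supported on
even `x` and `z` congruent to each other modulo `4`. -/
def oddEightFun (x y z : ℤ) : ℤ :=
  if x % 4 = 0 ∧ z % 4 = 0 then
    3 * x ^ 5 + 32 * x * y ^ 4 - x ^ 3 * z ^ 2 + 9 * x ^ 3 * y * z + x * y * z ^ 3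
  else if x % 4 = 2 ∧ z % 4 = 2 then 2 * x ^ 5 + 32 * x ^ 3 * y ^ 2 else 0

theorem oddEightFun_zero {x y z : ℤ} (hx : x % 4 = 0) (hz : z % 4 = 0) : oddEightFun x y z =
    3 * x ^ 5 + 32 * x * y ^ 4 - x ^ 3 * z ^ 2 + 9 * x ^ 3 * y * z + x * y * z ^ 3 :=
  if_pos ⟨hx, hz⟩

theorem oddEightFun_two {x y z : ℤ} (hx : x % 4 = 2) (hz : z % 4 = 2) :
    oddEightFun x y z = 2 * x ^ 5 + 32 * x ^ 3 * y ^ 2 := by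
  rw [oddEightFun, if_neg (by omega), if_pos ⟨hx, hz⟩]

theorem oddEightFun_ne {x y z : ℤ} (h : x % 2 = 1 ∨ x % 4 ≠ z % 4) : oddEightFun x y z = 0 := by
  rw [oddEightFun, if_neg (by omega), if_neg (by omega)]

/-- The first boundary sum for `oddEightFun`, up to the factor `3`. -/
theorem three_mul_sum_oddEightFun (l : ℤ) (k : ℕ) :
    3 * ∑ i ∈ Finset.range (4 * k + 1), oddEightFun (i + 1) l (i + 1) =
      512 * k ^ 2 * (k + 1) ^ 2 * (2 * k ^ 2 + 2 * k - 1) +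
      256 * l * k * (k + 1) * (2 * k + 1) * (3 * k ^ 2 + 3 * k - 1) +
      192 * l ^ 4 * k * (k + 1) + 64 * k ^ 2 * (16 * k ^ 4 - 20 * k ^ 2 + 7) +
      768 * l ^ 2 * k ^ 2 * (2 * k ^ 2 - 1) := by
  induction k with
  | zero => simp [oddEightFun]
  | succ k ih =>
    rw [show 4 * (k + 1) + 1 = 4 * k + 1 + 1 + 1 + 1 + 1 by ring, Finset.sum_range_succ,
      Finset.sum_range_succ, Finset.sum_range_succ, Finset.sum_range_succ, mul_add, mul_add,
      mul_add, mul_add, ih, oddEightFun_two (by push_cast; omega) (by push_cast; omega),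
      oddEightFun_ne (.inl (by push_cast; omega)),
      oddEightFun_zero (by push_cast; omega) (by push_cast; omega),
      oddEightFun_ne (.inl (by push_cast; omega))]
    push_cast
    ring

/-- The second boundary sum for `oddEightFun`, up to the factor `3`. -/
theorem three_mul_sum_oddEightFun' {l m : ℤ} (hl : l % 2 = 1) (hm : m % 2 = 0) (r : ℕ) :
    3 * ∑ i ∈ Finset.range (2 * r + 1), oddEightFun (2 * l) (m - i) (2 * (m - i)) =
      192 * r * l ^ 5 + 256 * l ^ 3 * (3 * r * m ^ 2 - 6 * m * r ^ 2 + r * (4 * r ^ 2 - 1)) := by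
  induction r with
  | zero =>
    rw [Finset.sum_range_one, oddEightFun_ne (.inr (by push_cast; omega))]
    simp
  | succ r ih =>
    rw [show 2 * (r + 1) + 1 = 2 * r + 1 + 1 + 1 by ring, Finset.sum_range_succ,
      Finset.sum_range_succ, mul_add, mul_add, ih,
      oddEightFun_two (by omega) (by push_cast; omega),
      oddEightFun_ne (.inr (by push_cast; omega))]
    push_cast
    ring

/-- Here the triples belong to numbers congruent to `1` modulo `8`, which may be squares: the two
boundary sums do not vanish, but they cancel. -/
theorem seven_mul_card_sqTuples_odd_eight {n : ℤ} (hn : n % 8 = 0) :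
    7 * ((sqTuples Odd 8 n).card : ℤ) =
      ∑ q ∈ factorPairs n, (if q.1 % 2 = 1 ∨ q.2 % 2 = 1 then 0 else
        if q.1 % 4 = 2 then -16 else if q.2 % 4 = 2 then 30 else -14) * q.1 ^ 3 := by
  set v : ℤ → ℤ → ℤ := fun d e => if d % 2 = 1 ∨ e % 2 = 1 then 0 else
        if d % 4 = 2 then -16 else if e % 4 = 2 then 30 else -14 with hv
  have horb0 : ∀ u d e, u % 2 = 1 → d % 2 = 1 → e % 4 = 0 →
      orbitSum (liouvilleTerm oddEightFun) u d e = orbitSum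
        (fun u d e => 2 * (u % 2 * ((d * e - (8 : ℕ) * u ^ 2) * (v d e * d ^ 3)))) u d e := by
    intro u d e h1 h2 h3
    simp only [orbitSum, liouvilleTerm, hv]
    rw [oddEightFun_ne (x := e - 2 * u) (.inr (by omega)),
      oddEightFun_ne (x := e - 2 * -u) (.inr (by omega)),
      oddEightFun_ne (x := d - 2 * u) (.inl (by omega)),
      oddEightFun_ne (x := d - 2 * -u) (.inl (by omega)),
      oddEightFun_ne (x := d + e) (y := u) (.inl (by omega)),
      oddEightFun_ne (x := d + e) (.inl (by omega)),
      oddEightFun_ne (x := e + d) (y := u) (.inl (by omega)),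
      oddEightFun_ne (x := e + d) (.inl (by omega)), if_pos (by omega), if_pos (by omega)]
    ring
  have horb2 : ∀ u d e, u % 2 = 1 → d % 4 = 0 → e % 4 = 2 →
      orbitSum (liouvilleTerm oddEightFun) u d e = orbitSum
        (fun u d e => 2 * (u % 2 * ((d * e - (8 : ℕ) * u ^ 2) * (v d e * d ^ 3)))) u d e := by
    intro u d e h1 h2 h3
    simp only [orbitSum, liouvilleTerm, hv]
    rw [oddEightFun_zero (x := e - 2 * u) (by omega) (by omega),
      oddEightFun_zero (x := e - 2 * -u) (by omega) (by omega),
      oddEightFun_two (x := d - 2 * u) (by omega) (by omega),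
      oddEightFun_two (x := d - 2 * -u) (by omega) (by omega),
      oddEightFun_two (x := d + e) (y := u) (by omega) (by omega),
      oddEightFun_two (x := d + e) (by omega) (by omega),
      oddEightFun_two (x := e + d) (y := u) (by omega) (by omega),
      oddEightFun_two (x := e + d) (by omega) (by omega), if_neg (by omega), if_neg (by omega),
      if_pos h3, if_neg (by omega), if_pos h3, h1, show -u % 2 = 1 by omega]
    push_cast
    ring
  refine mul_card_sqTuples_odd_eq_sum_of_liouville (k := 8) (K := 7) (c := 2) (F := oddEightFun)
    (w := fun d e => v d e * d ^ 3)
    (by norm_num) (by norm_num) ?_ ?_ ?_ ?_ ?_ hn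
  · intro x y z
    rcases Int.emod_two_eq_zero_or_one x with h | h
    · by_cases h1 : x % 4 = z % 4
      · by_cases h2 : x % 4 = 0
        · rw [oddEightFun_zero (by omega) (by omega), oddEightFun_zero (by omega) (by omega)]
          ring
        · rw [oddEightFun_two (by omega) (by omega), oddEightFun_two (by omega) (by omega)]
          ring
      · rw [oddEightFun_ne (.inr h1), oddEightFun_ne (.inr (by omega)), neg_zero]
    · rw [oddEightFun_ne (.inl h), oddEightFun_ne (.inl (by omega)), neg_zero]
  · intro x y z
    rcases Int.emod_two_eq_zero_or_one x with h | h
    · by_cases h1 : x % 4 = z % 4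
      · by_cases h2 : x % 4 = 0
        · rw [oddEightFun_zero (by omega) (by omega), oddEightFun_zero (by omega) (by omega)]
          ring
        · rw [oddEightFun_two (by omega) (by omega), oddEightFun_two (by omega) (by omega)]
          ring
      · rw [oddEightFun_ne (.inr h1), oddEightFun_ne (.inr (by omega))]
    · rw [oddEightFun_ne (.inl h), oddEightFun_ne (.inl (by omega))]
  · rw [sum_factorPairs 8 fun d e => v d e * d ^ 3]
    rfl
  · intro u d e h
    rcases emod_of_sq_add_mul_emod_eight_eq_one h with
      ⟨h1, h2, h3⟩ | ⟨h1, ⟨h2, h3⟩ | ⟨h2, h3⟩ | ⟨h2, h3⟩ | ⟨h2, h3⟩ | ⟨h2, h3⟩⟩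
    · have h0 : ∀ u d e, d % 2 = 1 → e % 2 = 1 → liouvilleTerm oddEightFun u d e = 0 :=
        fun u d e hd he => by
          rw [liouvilleTerm, oddEightFun_ne (.inl (by omega)), oddEightFun_ne (.inr (by omega))]
          rfl
      simp only [orbitSum]
      rw [h0 _ _ _ h2 h3, h0 _ _ _ h2 h3, h0 _ _ _ h3 h2, h0 _ _ _ h3 h2, h1,
        show -u % 2 = 0 by omega]
      ring
    · exact horb0 u d e h1 h2 h3
    · rw [orbitSum_swap, orbitSum_swap _ u d]
      exact horb0 u e d h1 h3 h2
    · have h0 : ∀ u d e, u % 2 = 1 → d % 4 = 0 → e % 4 = 0 →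
          liouvilleTerm oddEightFun u d e =
            2 * (2 * (e - 2 * u) ^ 5 + 32 * (e - 2 * u) ^ 3 * (u + d) ^ 2) -
              (3 * (d + e) ^ 5 + 32 * (d + e) * u ^ 4 - (d + e) ^ 3 * (d - e) ^ 2 +
                9 * (d + e) ^ 3 * u * (d - e) + (d + e) * u * (d - e) ^ 3) :=
        fun u d e hu hd he => by
        rw [liouvilleTerm, oddEightFun_two (by omega) (by omega),
          oddEightFun_zero (by omega) (by omega)]
      simp only [orbitSum, hv]
      rw [h0 _ _ _ h1 h2 h3, h0 _ _ _ (by omega) h2 h3, h0 _ _ _ h1 h3 h2,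
        h0 _ _ _ (by omega) h3 h2, h1, show -u % 2 = 1 by omega, if_neg (by omega),
        if_neg (by omega), if_neg (by omega), if_neg (by omega), if_neg (by omega),
        if_neg (by omega)]
      push_cast
      ring
    · exact horb2 u d e h1 h2 h3
    · rw [orbitSum_swap, orbitSum_swap _ u d]
      exact horb2 u e d h1 h3 h2
  · intro m h
    -- The square `(m + 1) ^ 2` is odd, so that `m` is even.
    obtain ⟨k, rfl⟩ : ∃ k, m = 2 * k := ⟨m / 2, by
      rcases Int.emod_two_eq_zero_or_one ((m : ℤ) + 1) with h' | h'
      · have := sq_emod_four_of_even h'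
        omega
      · omega⟩
    have e1 := three_mul_sum_oddEightFun ((2 * k : ℕ) + 1) k
    have e2 := three_mul_sum_oddEightFun' (l := (2 * k : ℕ) + 1) (m := (2 * k : ℕ))
      (by push_cast; omega) (by push_cast; omega) (2 * k)
    rw [show 4 * k + 1 = 2 * (2 * k) + 1 by ring] at e1
    rw [Finset.sum_sub_distrib, ← Finset.mul_sum]
    push_cast at e1 e2 ⊢
    refine (mul_eq_zero.1 (?_ : (3 : ℤ) * _ = 0)).resolve_left three_ne_zero
    rw [mul_sub, mul_left_comm, e1, e2]
    ring

end OddSquares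

/-! ### Divisor sums -/

section DivisorSums

theorem sum_factorPairs_swap (n : ℤ) (f : ℤ → ℤ → ℤ) :
    ∑ q ∈ factorPairs n, f q.1 q.2 = ∑ q ∈ factorPairs n, f q.2 q.1 := by
  refine Finset.sum_nbij' Prod.swap Prod.swap ?_ ?_ (by simp) (by simp) (by simp)
  all_goals
    rintro ⟨d, e⟩ h
    rw [mem_factorPairs] at h
    rw [Prod.swap, mem_factorPairs]
    exact ⟨h.2.1, h.1, by rw [mul_comm]; exact h.2.2⟩

theorem sum_factorPairs_mul_right {k : ℤ} (hk : 0 < k) (n : ℤ) (f : ℤ → ℤ → ℤ) :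
    ∑ q ∈ factorPairs (k * n), (if q.2 % k = 0 then f q.1 q.2 else 0) =
      ∑ q ∈ factorPairs n, f q.1 (k * q.2) := by
  rw [← Finset.sum_filter]
  refine Finset.sum_nbij' (fun q => (q.1, q.2 / k)) (fun q => (q.1, k * q.2)) ?_ ?_ ?_ ?_ ?_
  · rintro ⟨d, e⟩ h
    simp only [Finset.mem_filter, mem_factorPairs] at h ⊢
    obtain ⟨⟨h1, h2, h3⟩, h4⟩ := h
    obtain ⟨e, rfl⟩ := Int.dvd_of_emod_eq_zero h4
    rw [Int.mul_ediv_cancel_left _ hk.ne']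
    exact ⟨h1, pos_of_mul_pos_right h2 hk.le, mul_left_cancel₀ hk.ne' (by rw [← h3]; ring)⟩
  · rintro ⟨d, e⟩ h
    simp only [Finset.mem_filter, mem_factorPairs] at h ⊢
    obtain ⟨h1, h2, h3⟩ := h
    exact ⟨⟨h1, mul_pos hk h2, by rw [← h3]; ring⟩, Int.mul_emod_right _ _⟩
  · rintro ⟨d, e⟩ h
    simp only [Finset.mem_filter] at h
    simp only [Int.mul_ediv_cancel' (Int.dvd_of_emod_eq_zero h.2)]
  · rintro ⟨d, e⟩ -
    simp only [Int.mul_ediv_cancel_left _ hk.ne']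
  · rintro ⟨d, e⟩ h
    simp only [Finset.mem_filter] at h
    simp only [Int.mul_ediv_cancel' (Int.dvd_of_emod_eq_zero h.2)]

theorem sum_factorPairs_mul_left {k : ℤ} (hk : 0 < k) (n : ℤ) (f : ℤ → ℤ → ℤ) :
    ∑ q ∈ factorPairs (k * n), (if q.1 % k = 0 then f q.1 q.2 else 0) =
      ∑ q ∈ factorPairs n, f (k * q.1) q.2 := by
  rw [sum_factorPairs_swap _ fun a b => if a % k = 0 then f a b else 0,
    sum_factorPairs_mul_right hk n fun a b => f b a,
    sum_factorPairs_swap _ fun a b => f (k * b) a]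

/-- A factor `k` of the second divisor can be moved to the first one. -/
theorem sum_factorPairs_move {k : ℤ} (hk : 0 < k) (n : ℤ) (f : ℤ → ℤ) :
    ∑ q ∈ factorPairs n, (if q.2 % k = 0 then f (k * q.1) else 0) =
      ∑ q ∈ factorPairs n, (if q.1 % k = 0 then f q.1 else 0) := by
  by_cases h : k ∣ n
  · obtain ⟨m, rfl⟩ := h
    rw [sum_factorPairs_mul_right hk m fun a _ => f (k * a),
      sum_factorPairs_mul_left hk m fun a _ => f a]
  · rw [Finset.sum_eq_zero, Finset.sum_eq_zero]
    · rintro ⟨d, e⟩ hq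
      refine if_neg fun h' => h ?_
      rw [← (mem_factorPairs.1 hq).2.2]
      exact (Int.dvd_of_emod_eq_zero h').mul_right e
    · rintro ⟨d, e⟩ hq
      refine if_neg fun h' => h ?_
      rw [← (mem_factorPairs.1 hq).2.2]
      exact (Int.dvd_of_emod_eq_zero h').mul_left d

/-- Two sums agree if their summands differ by a multiple of the difference of the summands in a
known equality of sums. -/
theorem sum_eq_sum_of_sub_eq {s : Finset (ℤ × ℤ)} {A B L R : ℤ × ℤ → ℤ} (c : ℤ)
    (h : ∑ q ∈ s, L q = ∑ q ∈ s, R q) (H : ∀ q ∈ s, A q - B q = c * (L q - R q)) :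
    ∑ q ∈ s, A q = ∑ q ∈ s, B q := by
  rw [← sub_eq_zero, ← Finset.sum_sub_distrib, Finset.sum_congr rfl H, ← Finset.mul_sum,
    Finset.sum_sub_distrib, h, sub_self, mul_zero]

theorem weights_natCast {N : ℕ} [NeZero N] (c : Fin N → ℂ) (a : ℕ) :
    weights N c (a : ZMod N) = c ⟨a % N, Nat.mod_lt a (NeZero.pos N)⟩ := by
  simp only [weights, ZMod.val_natCast]

/-- The list of weights only has to be read off at the divisors of `n`. -/
theorem weightedSigma_weights {N : ℕ} [NeZero N] (k n : ℕ) {c : Fin N → ℂ} (f : ℤ → ℤ)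
    (hf : ∀ a : ℕ, a ∣ n → c ⟨a % N, Nat.mod_lt a (NeZero.pos N)⟩ = f a) :
    weightedSigma k n (weights N c) = ((∑ q ∈ factorPairs n, f q.1 * q.1 ^ k : ℤ) : ℂ) := by
  rw [sum_factorPairs n fun a _ => f a * a ^ k,
    Nat.sum_divisorsAntidiagonal (fun a _ => f a * (a : ℤ) ^ k), weightedSigma]
  push_cast
  refine Finset.sum_congr rfl fun a ha => ?_
  rw [weights_natCast, hf a (Nat.dvd_of_mem_divisors ha)]

theorem weightedSigmaConj_weights {N : ℕ} [NeZero N] (k n : ℕ) {c : Fin N → ℂ} (f : ℤ → ℤ)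
    (hf : ∀ a : ℕ, a ∣ n → c ⟨a % N, Nat.mod_lt a (NeZero.pos N)⟩ = f a) :
    weightedSigmaConj k n (weights N c) =
      ((∑ q ∈ factorPairs n, f q.2 * q.1 ^ k : ℤ) : ℂ) := by
  rw [sum_factorPairs n fun a b => f b * a ^ k,
    Nat.sum_divisorsAntidiagonal (fun a b => f b * (a : ℤ) ^ k), weightedSigmaConj]
  push_cast
  refine Finset.sum_congr rfl fun a ha => ?_
  rw [weights_natCast, hf _ (Nat.div_dvd_of_dvd (Nat.dvd_of_mem_divisors ha))]
  simp

theorem mod_four_cases (a : ℕ) :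
    (a % 4 = 0 ∧ (a : ℤ) % 4 = 0) ∨ (a % 4 = 1 ∧ (a : ℤ) % 4 = 1) ∨
      (a % 4 = 2 ∧ (a : ℤ) % 4 = 2) ∨ (a % 4 = 3 ∧ (a : ℤ) % 4 = 3) := by
  omega

theorem chi4_eq_fin (a : ℕ) : (![0, 1, 0, -1] : Fin 4 → ℂ) ⟨a % 4, Nat.mod_lt a (by norm_num)⟩ =
    (chi4 a : ℂ) := by
  rw [chi4_eq]
  rcases mod_four_cases a with ⟨h, h'⟩ | ⟨h, h'⟩ | ⟨h, h'⟩ | ⟨h, h'⟩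
  · rw [if_pos (by omega)]; simp [h]
  · rw [if_neg (by omega), if_pos h']; simp [h]
  · rw [if_pos (by omega)]; simp [h]
  · rw [if_neg (by omega), if_neg (by omega)]; simp [h]

theorem mod_two_of_dvd {a n : ℕ} (h : a ∣ n) (hn : n % 2 = 1) : a % 2 = 1 := by
  rw [← Nat.odd_iff] at hn ⊢
  exact hn.of_dvd_nat h

end DivisorSums

/-! ### The formulas for squares -/

section Squares

theorem squareReps_two {n : ℕ} (hn : 1 ≤ n) :
    (squareReps 2 n : ℂ) = 4 * weightedSigma 0 n (weights 4 ![0, 1, 0, -1]) := by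
  rw [weightedSigma_weights 0 n chi4 fun a _ => chi4_eq_fin a, squareReps_eq_card]
  have h := card_sqTuples_two (n := n) (by omega)
  rw [← Finset.mul_sum] at h
  exact_mod_cast h.trans (by simp)

theorem squareReps_four {n : ℕ} (hn : 1 ≤ n) :
    (squareReps 4 n : ℂ) = 8 * weightedSigma 1 n (weights 4 ![0, 1, 1, 1]) ∧
      (squareReps 4 n : ℂ) = 8 * weightedSigmaConj 1 n (weights 4 ![-3, 1, 1, 1]) := by
  have h := card_sqTuples_four (n := n) (by omega)
  rw [← Finset.mul_sum] at h
  have h1 : ∑ q ∈ factorPairs n, (3 - 2 * (q.2 % 2)) * (q.1 % 2) * q.1 =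
      ∑ q ∈ factorPairs n, (if q.1 % 4 = 0 then 0 else 1) * q.1 ^ 1 := by
    refine sum_eq_sum_of_sub_eq 1
      (sum_factorPairs_move two_pos n fun a => if a % 4 = 2 then a else 0) ?_
    rintro ⟨a, b⟩ -
    simp only [pow_one]
    rcases Int.emod_two_eq_zero_or_one a with ha | ha <;>
      rcases Int.emod_two_eq_zero_or_one b with hb | hb <;> rw [ha, hb] <;> split_ifs <;> omega
  have h2 : ∑ q ∈ factorPairs n, (if q.1 % 4 = 0 then 0 else 1) * q.1 ^ 1 =
      ∑ q ∈ factorPairs n, (if q.2 % 4 = 0 then -3 else 1) * q.1 ^ 1 := by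
    refine sum_eq_sum_of_sub_eq 1 (sum_factorPairs_move four_pos n fun a => a) ?_
    rintro ⟨a, b⟩ -
    simp only [pow_one]
    split_ifs <;> omega
  rw [h1] at h
  constructor
  · rw [weightedSigma_weights 1 n (fun a => if a % 4 = 0 then 0 else 1), squareReps_eq_card]
    · exact_mod_cast h
    · intro a _
      rcases mod_four_cases a with ⟨h, h'⟩ | ⟨h, h'⟩ | ⟨h, h'⟩ | ⟨h, h'⟩ <;> simp [h, h']
  · rw [weightedSigmaConj_weights 1 n (fun a => if a % 4 = 0 then -3 else 1), squareReps_eq_card,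
      ← h2]
    · exact_mod_cast h
    · intro a _
      rcases mod_four_cases a with ⟨h, h'⟩ | ⟨h, h'⟩ | ⟨h, h'⟩ | ⟨h, h'⟩ <;> simp [h, h']

theorem squareReps_six {n : ℕ} (hn : 1 ≤ n) :
    (squareReps 6 n : ℂ) = 16 * weightedSigmaConj 2 n (weights 4 ![0, 1, 0, -1]) -
      4 * weightedSigma 2 n (weights 4 ![0, 1, 0, -1]) := by
  rw [weightedSigma_weights 2 n chi4 fun a _ => chi4_eq_fin a,
    weightedSigmaConj_weights 2 n chi4 fun a _ => chi4_eq_fin a, squareReps_eq_card]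
  have h := card_sqTuples_six (n := n) (by omega)
  simp only [sub_mul, mul_assoc, Finset.sum_sub_distrib, ← Finset.mul_sum] at h
  exact_mod_cast h

theorem squareReps_eight {n : ℕ} (hn : 1 ≤ n) :
    (squareReps 8 n : ℂ) = 4 * weightedSigma 3 n (weights 4 ![4, 4, 3, 4]) ∧
      (squareReps 8 n : ℂ) = 16 * weightedSigmaConj 3 n (weights 4 ![15, 1, -1, 1]) := by
  have h := seven_mul_card_sqTuples_eight (n := n) (by omega)
  have h1 : ∑ q ∈ factorPairs n, 16 *
        ((8 * (q.2 % 2) - 15 * (q.1 % 2) + 14 * (q.1 % 2) * (q.2 % 2)) * q.1 ^ 3) =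
      ∑ q ∈ factorPairs n, (112 * q.1 ^ 3 - if q.1 % 4 = 2 then 28 * q.1 ^ 3 else 0) := by
    refine sum_eq_sum_of_sub_eq (-1) (sum_factorPairs_move two_pos n
      fun a => if a % 4 = 2 then 44 * a ^ 3 else 16 * a ^ 3) ?_
    rintro ⟨a, b⟩ -
    simp only
    rcases Int.emod_two_eq_zero_or_one a with ha | ha <;>
      rcases Int.emod_two_eq_zero_or_one b with hb | hb <;> rw [ha, hb] <;> split_ifs <;>
      first | omega | ring
  have h2 : ∑ q ∈ factorPairs n, (112 * q.1 ^ 3 - if q.1 % 4 = 2 then 28 * q.1 ^ 3 else 0) =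
      ∑ q ∈ factorPairs n, (112 * q.1 ^ 3 - (if q.2 % 2 = 0 then 224 * q.1 ^ 3 else 0) +
        if q.1 % 4 = 0 then 28 * q.1 ^ 3 else 0) := by
    refine sum_eq_sum_of_sub_eq 1 (sum_factorPairs_move two_pos n fun a => 28 * a ^ 3) ?_
    rintro ⟨a, b⟩ -
    simp only
    split_ifs <;> first | omega | ring
  have h3 : ∑ q ∈ factorPairs n, (112 * q.1 ^ 3 - (if q.2 % 2 = 0 then 224 * q.1 ^ 3 else 0) +
        if q.1 % 4 = 0 then 28 * q.1 ^ 3 else 0) =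
      ∑ q ∈ factorPairs n, 7 * (16 *
        ((if q.2 % 4 = 0 then 15 else if q.2 % 4 = 2 then -1 else 1) * q.1 ^ 3)) := by
    refine sum_eq_sum_of_sub_eq (-1) (sum_factorPairs_move four_pos n fun a => 28 * a ^ 3) ?_
    rintro ⟨a, b⟩ -
    simp only
    split_ifs <;> first | omega | ring
  constructor
  · have h4 : ∑ q ∈ factorPairs n, (112 * q.1 ^ 3 - if q.1 % 4 = 2 then 28 * q.1 ^ 3 else 0) =
        ∑ q ∈ factorPairs n, 7 * (4 * ((if q.1 % 4 = 2 then 3 else 4) * q.1 ^ 3)) := by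
      refine Finset.sum_congr rfl fun q _ => ?_
      split_ifs <;> ring
    rw [h1, h4, ← Finset.mul_sum, ← Finset.mul_sum] at h
    rw [weightedSigma_weights 3 n (fun a => if a % 4 = 2 then 3 else 4), squareReps_eq_card]
    · exact_mod_cast mul_left_cancel₀ (by norm_num) h
    · intro a _
      rcases mod_four_cases a with ⟨h, h'⟩ | ⟨h, h'⟩ | ⟨h, h'⟩ | ⟨h, h'⟩ <;> simp [h, h']
  · rw [h1, h2, h3, ← Finset.mul_sum, ← Finset.mul_sum] at h
    rw [weightedSigmaConj_weights 3 n
      (fun a => if a % 4 = 0 then 15 else if a % 4 = 2 then -1 else 1), squareReps_eq_card]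
    · exact_mod_cast mul_left_cancel₀ (by norm_num) h
    · intro a _
      rcases mod_four_cases a with ⟨h, h'⟩ | ⟨h, h'⟩ | ⟨h, h'⟩ | ⟨h, h'⟩ <;> simp [h, h']

end Squares

/-! ### The formulas for triangles -/

section Triangles

theorem triangleReps_two (n : ℕ) :
    (triangleReps 2 n : ℂ) =
        4 * weightedSigma 0 (4 * n + 1) (weights 8 ![0, 1, -1, -1, 0, 1, 1, -1]) ∧
      (triangleReps 2 n : ℂ) = 4 * weightedSigma 0 (8 * n + 2) (weights 4 ![0, 1, 0, -1]) := by
  have hcard : (sqTuples Odd 2 (8 * n + 2)).card =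
      (sqTuples (fun _ => True) 2 (8 * n + 2)).card := by
    congr 1
    ext x
    simp only [mem_sqTuples, Fin.forall_fin_two, Fin.sum_univ_two]
    refine ⟨fun h => ⟨⟨trivial, trivial⟩, h.2⟩, fun h => ⟨?_, h.2⟩⟩
    have key : ∀ a b : ℤ, a ^ 2 + b ^ 2 = 8 * n + 2 → Odd a := fun a b h => by
      by_contra ha
      have h1 := sq_emod_four_of_even (Int.even_iff.1 (Int.not_odd_iff_even.1 ha))
      rcases sq_emod_eight b with h | h | h <;> omega
    exact ⟨key _ _ h.2, key _ (x 0) (by rw [add_comm]; exact h.2)⟩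
  have h := card_sqTuples_two (n := 8 * n + 2) (by omega)
  rw [← hcard, ← Finset.mul_sum] at h
  have h2 : ∑ q ∈ factorPairs (8 * n + 2), chi4 q.1 = ∑ q ∈ factorPairs (4 * n + 1), chi4 q.1 := by
    rw [← sum_factorPairs_mul_right two_pos (4 * n + 1) fun a _ => chi4 a,
      show (2 : ℤ) * (4 * n + 1) = 8 * n + 2 by ring]
    refine Finset.sum_congr rfl ?_
    rintro ⟨a, b⟩ hq
    simp only
    split_ifs with hb
    · rfl
    · refine chi4_of_even ?_
      have h3 := (mem_factorPairs.1 hq).2.2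
      rw [show (8 : ℤ) * n + 2 = 2 * (4 * n + 1) by ring] at h3
      have h4 := (Int.even_mul.1 (h3 ▸ even_two_mul _ : Even (a * b)))
      rw [Int.even_iff, Int.even_iff] at h4
      exact h4.resolve_right hb
  rw [triangleReps_eq_card]
  constructor
  · rw [weightedSigma_weights 0 (4 * n + 1) chi4]
    · rw [h2] at h
      exact_mod_cast h.trans (by simp)
    · intro a ha
      have h1 := mod_two_of_dvd ha (by omega)
      have h3 : a % 8 = 1 ∨ a % 8 = 3 ∨ a % 8 = 5 ∨ a % 8 = 7 := by omega
      rw [chi4_eq, if_neg (by omega)]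
      rcases h3 with h3 | h3 | h3 | h3
      · rw [if_pos (by omega)]; simp [h3]
      · rw [if_neg (by omega)]; simp [h3]
      · rw [if_pos (by omega)]; simp [h3]
      · rw [if_neg (by omega)]; simp [h3]
  · rw [weightedSigma_weights 0 (8 * n + 2) chi4 fun a _ => chi4_eq_fin a]
    exact_mod_cast h.trans (by simp)

theorem triangleReps_four (n : ℕ) :
    (triangleReps 4 n : ℂ) = 8 * weightedSigma 1 (2 * n + 1) (weights 4 ![0, 2, -1, 2]) ∧
      (triangleReps 4 n : ℂ) = 16 * weightedSigmaConj 1 (2 * n + 1) (weights 4 ![0, 1, -2, 1]) ∧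
      (triangleReps 4 n : ℂ) = 16 * weightedSigma 1 (2 * n + 1) (weights 1 ![1]) ∧
      (triangleReps 4 n : ℂ) = 16 * weightedSigmaConj 1 (2 * n + 1) (weights 1 ![1]) := by
  have h := card_sqTuples_odd_four (n := 8 * n + 4) (by omega)
  have h2 : ∑ q ∈ factorPairs (8 * n + 4),
      (if q.1 % 4 = 2 ∧ q.2 % 4 = 2 then 8 * q.1 else 0) =
      16 * ∑ q ∈ factorPairs (2 * n + 1), q.1 := by
    have h3 : ∑ q ∈ factorPairs (2 * n + 1), 16 * q.1 =
        ∑ q ∈ factorPairs (2 * n + 1), 8 * (2 * q.1) :=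
      Finset.sum_congr rfl fun q _ => by ring
    rw [Finset.mul_sum, h3, ← sum_factorPairs_mul_left two_pos (2 * n + 1) fun a _ => 8 * a,
      ← sum_factorPairs_mul_right two_pos (2 * (2 * n + 1)) fun a _ =>
        if a % 2 = 0 then 8 * a else 0, show (2 : ℤ) * (2 * (2 * n + 1)) = 8 * n + 4 by ring]
    refine Finset.sum_congr rfl ?_
    rintro ⟨a, b⟩ hq
    have h3 := (mem_factorPairs.1 hq).2.2
    simp only
    by_cases hab : b % 2 = 0 ∧ a % 2 = 0
    · rw [if_pos hab.1, if_pos hab.2, if_pos]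
      obtain ⟨a, rfl⟩ := Int.dvd_of_emod_eq_zero hab.2
      obtain ⟨b, rfl⟩ := Int.dvd_of_emod_eq_zero hab.1
      have h4 : Odd (a * b) := ⟨n, by linarith⟩
      rw [Int.odd_mul, Int.odd_iff, Int.odd_iff] at h4
      omega
    · rw [if_neg (by omega)]
      split_ifs <;> omega
  rw [h2] at h
  have h8 : ((sqTuples Odd 4 (8 * n + 4)).card : ℤ) =
      8 * ∑ q ∈ factorPairs (2 * n + 1), 2 * q.1 ^ 1 := by
    rw [h, Finset.mul_sum, Finset.mul_sum]
    exact Finset.sum_congr rfl fun q _ => by ring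
  have h16 : ((sqTuples Odd 4 (8 * n + 4)).card : ℤ) =
      16 * ∑ q ∈ factorPairs (2 * n + 1), 1 * q.1 ^ 1 := by
    rw [h]
    simp
  rw [triangleReps_eq_card]
  refine ⟨?_, ?_, ?_, ?_⟩
  · rw [weightedSigma_weights 1 (2 * n + 1) fun _ => 2]
    · exact_mod_cast h8
    · intro a ha
      have h1 := mod_two_of_dvd ha (by omega)
      have h3 : a % 4 = 1 ∨ a % 4 = 3 := by omega
      rcases h3 with h3 | h3 <;> simp [h3]
  · rw [weightedSigmaConj_weights 1 (2 * n + 1) fun _ => 1]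
    · exact_mod_cast h16
    · intro a ha
      have h1 := mod_two_of_dvd ha (by omega)
      have h3 : a % 4 = 1 ∨ a % 4 = 3 := by omega
      rcases h3 with h3 | h3 <;> simp [h3]
  · rw [weightedSigma_weights 1 (2 * n + 1) fun _ => 1]
    · exact_mod_cast h16
    · intro a _
      simp
  · rw [weightedSigmaConj_weights 1 (2 * n + 1) fun _ => 1]
    · exact_mod_cast h16
    · intro a _
      simp

theorem triangleReps_six (n : ℕ) :
    (triangleReps 6 n : ℂ) =
        weightedSigma 2 (4 * n + 3) (weights 8 ![0, -4, 1, 4, 0, -4, -1, 4]) +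
          4 * weightedSigmaConj 2 (4 * n + 3) (weights 8 ![0, 1, -4, -1, 0, 1, 4, -1]) ∧
      (triangleReps 6 n : ℂ) = 8 * weightedSigma 2 (4 * n + 3) (weights 4 ![0, -1, 0, 1]) := by
  have h := card_sqTuples_odd_six (n := 8 * n + 6) (by omega)
  have hchi : ∀ q ∈ factorPairs (4 * n + 3), chi4 q.2 = -chi4 q.1 := by
    rintro ⟨a, b⟩ hq
    have h1 := (mem_factorPairs.1 hq).2.2
    have h2 : chi4 a * chi4 b = -1 := by
      rw [← chi4_mul, h1, chi4_eq, if_neg (by omega), if_neg (by omega)]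
    rcases Int.mul_eq_neg_one_iff_eq_one_or_neg_one.1 h2 with ⟨h3, h4⟩ | ⟨h3, h4⟩ <;>
      simp [h3, h4]
  -- Of the two divisors of `2 (4 n + 3)` exactly one is even, and `χ₄` vanishes there.
  have h2 : ∑ q ∈ factorPairs (8 * n + 6), (chi4 q.2 - 4 * chi4 q.1) * q.1 ^ 2 =
      ∑ q ∈ factorPairs (4 * n + 3), 8 * (-chi4 q.1 * q.1 ^ 2) := by
    have h3 : ∑ q ∈ factorPairs (8 * n + 6), (chi4 q.2 - 4 * chi4 q.1) * q.1 ^ 2 =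
        ∑ q ∈ factorPairs (2 * (4 * n + 3)), (if q.1 % 2 = 0 then chi4 q.2 * q.1 ^ 2 else 0) -
        ∑ q ∈ factorPairs (2 * (4 * n + 3)),
          (if q.2 % 2 = 0 then 4 * chi4 q.1 * q.1 ^ 2 else 0) := by
      rw [← Finset.sum_sub_distrib, show (2 : ℤ) * (4 * n + 3) = 8 * n + 6 by ring]
      refine Finset.sum_congr rfl ?_
      rintro ⟨a, b⟩ hq
      have h3 := (mem_factorPairs.1 hq).2.2
      rw [show (8 : ℤ) * n + 6 = 2 * (4 * n + 3) by ring] at h3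
      have h4 := (Int.even_mul.1 (h3 ▸ even_two_mul _ : Even (a * b)))
      rw [Int.even_iff, Int.even_iff] at h4
      simp only
      split_ifs with ha hb hb
      · rw [chi4_of_even ha, chi4_of_even hb]; ring
      · rw [chi4_of_even ha]; ring
      · rw [chi4_of_even hb]; ring
      · omega
    rw [h3, sum_factorPairs_mul_left two_pos (4 * n + 3) fun a b => chi4 b * a ^ 2,
      sum_factorPairs_mul_right two_pos (4 * n + 3) fun a _ => 4 * chi4 a * a ^ 2,
      ← Finset.sum_sub_distrib]
    refine Finset.sum_congr rfl fun q hq => ?_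
    rw [hchi q hq]
    ring
  rw [h2] at h
  have h4 : ((sqTuples Odd 6 (8 * n + 6)).card : ℤ) =
      ∑ q ∈ factorPairs (4 * n + 3), -4 * chi4 q.1 * q.1 ^ 2 +
        4 * ∑ q ∈ factorPairs (4 * n + 3), chi4 q.2 * q.1 ^ 2 := by
    rw [h, Finset.mul_sum, ← Finset.sum_add_distrib]
    refine Finset.sum_congr rfl fun q hq => ?_
    rw [hchi q hq]
    ring
  rw [triangleReps_eq_card]
  constructor
  · rw [weightedSigma_weights 2 (4 * n + 3) fun a => -4 * chi4 a,
      weightedSigmaConj_weights 2 (4 * n + 3) chi4]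
    · exact_mod_cast h4
    all_goals
      intro a ha
      have h1 := mod_two_of_dvd ha (by omega)
      have h3 : a % 8 = 1 ∨ a % 8 = 3 ∨ a % 8 = 5 ∨ a % 8 = 7 := by omega
      rw [chi4_eq, if_neg (by omega)]
      rcases h3 with h3 | h3 | h3 | h3
      · rw [if_pos (by omega)]; simp [h3]
      · rw [if_neg (by omega)]; simp [h3]
      · rw [if_pos (by omega)]; simp [h3]
      · rw [if_neg (by omega)]; simp [h3]
  · rw [weightedSigma_weights 2 (4 * n + 3) fun a => -chi4 a]
    · rw [← Finset.mul_sum] at h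
      exact_mod_cast h
    · intro a _
      rw [chi4_eq]
      rcases mod_four_cases a with ⟨h, h'⟩ | ⟨h, h'⟩ | ⟨h, h'⟩ | ⟨h, h'⟩
      · rw [if_pos (by omega)]; simp [h]
      · rw [if_neg (by omega), if_pos h']; simp [h]
      · rw [if_pos (by omega)]; simp [h]
      · rw [if_neg (by omega), if_neg (by omega)]; simp [h]

theorem triangleReps_eight (n : ℕ) :
    (triangleReps 8 n : ℂ) = 4 * weightedSigma 3 (2 * n + 2) (weights 4 ![7, 0, 8, 0]) ∧
      (triangleReps 8 n : ℂ) = 256 * weightedSigmaConj 3 (2 * n + 2) (weights 4 ![0, 0, 1, 0]) ∧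
      (triangleReps 8 n : ℂ) = 32 * weightedSigma 3 (n + 1) (weights 2 ![7, 8]) ∧
      (triangleReps 8 n : ℂ) = 256 * weightedSigmaConj 3 (n + 1) (weights 2 ![0, 1]) := by
  have h := seven_mul_card_sqTuples_odd_eight (n := 8 * n + 8) (by omega)
  set m : ℤ := n + 1 with hm
  have h2 : ∑ q ∈ factorPairs (8 * n + 8), (if q.1 % 2 = 1 ∨ q.2 % 2 = 1 then 0 else
        if q.1 % 4 = 2 then -16 else if q.2 % 4 = 2 then 30 else -14) * q.1 ^ 3 =
      ∑ q ∈ factorPairs m, 7 * (256 * (q.2 % 2 * q.1 ^ 3)) := by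
    -- Only the factorizations of `8 m` into two even numbers have nonzero weight; halving both
    -- factors leads to the factorizations of `2 m`.
    have h3 : ∑ q ∈ factorPairs (8 * n + 8), (if q.1 % 2 = 1 ∨ q.2 % 2 = 1 then 0 else
        if q.1 % 4 = 2 then -16 else if q.2 % 4 = 2 then 30 else -14) * q.1 ^ 3 =
        ∑ q ∈ factorPairs (2 * m), (if q.1 % 2 = 1 then -16 else if q.2 % 2 = 1 then 30 else -14) *
          (2 * q.1) ^ 3 := by
      obtain ⟨g, hg⟩ : ∃ g : ℤ → ℤ → ℤ, ∀ a b,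
        g a b = (if a % 4 = 2 then -16 else if b % 4 = 2 then 30 else -14) * a ^ 3 :=
        ⟨_, fun _ _ => rfl⟩
      have e1 := sum_factorPairs_mul_right two_pos (2 * (2 * m)) fun a b =>
        if a % 2 = 0 then g a b else 0
      rw [sum_factorPairs_mul_left two_pos (2 * m) fun a b => g a (2 * b),
        show 2 * (2 * (2 * m)) = 8 * n + 8 by rw [hm]; ring] at e1
      refine Eq.trans (Finset.sum_congr rfl fun q _ => ?_)
        (e1.trans (Finset.sum_congr rfl fun q _ => ?_))
      · rw [hg]
        split_ifs <;> omega
      · rw [hg]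
        split_ifs <;> omega
    have h4 : ∑ q ∈ factorPairs (2 * m), (if q.1 % 2 = 1 then -16 else
          if q.2 % 2 = 1 then 30 else -14) * (2 * q.1) ^ 3 =
        ∑ q ∈ factorPairs (2 * m), (if q.1 % 2 = 0 then 8 *
          (if q.2 % 2 = 1 then 30 else 2) * q.1 ^ 3 else 0) -
        ∑ q ∈ factorPairs (2 * m), (if q.2 % 2 = 0 then 8 * 16 * q.1 ^ 3 else 0) := by
      rw [← Finset.sum_sub_distrib]
      refine Finset.sum_congr rfl ?_
      rintro ⟨a, b⟩ hq
      have h5 := Int.even_mul.1 ((mem_factorPairs.1 hq).2.2 ▸ even_two_mul m : Even (a * b))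
      rw [Int.even_iff, Int.even_iff] at h5
      simp only
      split_ifs <;> first | omega | ring
    rw [h3, h4, sum_factorPairs_mul_left two_pos m fun a b =>
      8 * (if b % 2 = 1 then 30 else 2) * a ^ 3, sum_factorPairs_mul_right two_pos m fun a _ =>
      8 * 16 * a ^ 3, ← Finset.sum_sub_distrib]
    refine Finset.sum_congr rfl fun q _ => ?_
    rcases Int.emod_two_eq_zero_or_one q.2 with hb | hb <;> rw [hb]
    · rw [if_neg (by norm_num)]; ring
    · rw [if_pos rfl]; ring
  rw [h2, ← Finset.mul_sum, ← Finset.mul_sum] at h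
  replace h := mul_left_cancel₀ (by norm_num) h
  have c1 : ∑ q ∈ factorPairs m, 256 * (q.2 % 2 * q.1 ^ 3) =
      ∑ q ∈ factorPairs m, 32 * ((7 + q.1 % 2) * q.1 ^ 3) := by
    refine sum_eq_sum_of_sub_eq (-1) (sum_factorPairs_move two_pos m fun a => 32 * a ^ 3) ?_
    rintro ⟨a, b⟩ -
    simp only
    rcases Int.emod_two_eq_zero_or_one a with ha | ha <;>
      rcases Int.emod_two_eq_zero_or_one b with hb | hb <;> rw [ha, hb] <;> norm_num <;> ring
  have c2 : ∑ q ∈ factorPairs (2 * m), (if q.2 % 4 = 2 then 1 else 0) * q.1 ^ 3 =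
      ∑ q ∈ factorPairs m, q.2 % 2 * q.1 ^ 3 := by
    have e1 := sum_factorPairs_mul_right two_pos m fun a b =>
      (if b % 4 = 2 then 1 else 0) * a ^ 3
    refine Eq.trans (Finset.sum_congr rfl fun q _ => ?_)
      (e1.trans (Finset.sum_congr rfl fun q _ => ?_))
    · split_ifs <;> omega
    · rcases Int.emod_two_eq_zero_or_one q.2 with hb | hb <;> rw [hb] <;> split_ifs <;>
        omega
  have c3 : ∑ q ∈ factorPairs (2 * m),
      (if q.1 % 4 = 0 then 7 else if q.1 % 4 = 2 then 8 else 0) * q.1 ^ 3 =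
      ∑ q ∈ factorPairs m, 8 * ((7 + q.1 % 2) * q.1 ^ 3) := by
    have e1 := sum_factorPairs_mul_left two_pos m fun a _ =>
      (if a % 4 = 0 then 7 else 8) * a ^ 3
    refine Eq.trans (Finset.sum_congr rfl fun q _ => ?_)
      (e1.trans (Finset.sum_congr rfl fun q _ => ?_))
    · split_ifs <;> omega
    · rcases Int.emod_two_eq_zero_or_one q.1 with hb | hb <;> rw [hb] <;> split_ifs <;>
        first | omega | ring
  have h2m : ((2 * n + 2 : ℕ) : ℤ) = 2 * m := by rw [hm]; push_cast; ring
  have h1m : ((n + 1 : ℕ) : ℤ) = m := by rw [hm]; push_cast; ring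
  rw [triangleReps_eq_card]
  refine ⟨?_, ?_, ?_, ?_⟩
  · rw [weightedSigma_weights 3 (2 * n + 2)
      fun a => if a % 4 = 0 then 7 else if a % 4 = 2 then 8 else 0]
    · rw [h2m, c3]
      rw [Finset.mul_sum, c1, ← Finset.mul_sum, show (32 : ℤ) = 4 * 8 by norm_num, mul_assoc] at h
      rw [← Finset.mul_sum]
      exact_mod_cast h
    · intro a _
      rcases mod_four_cases a with ⟨h, h'⟩ | ⟨h, h'⟩ | ⟨h, h'⟩ | ⟨h, h'⟩ <;> simp [h, h']
  · rw [weightedSigmaConj_weights 3 (2 * n + 2) fun a => if a % 4 = 2 then 1 else 0]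
    · rw [h2m, c2]
      exact_mod_cast h
    · intro a _
      rcases mod_four_cases a with ⟨h, h'⟩ | ⟨h, h'⟩ | ⟨h, h'⟩ | ⟨h, h'⟩ <;> simp [h, h']
  · rw [weightedSigma_weights 3 (n + 1) fun a => 7 + a % 2]
    · rw [h1m]
      rw [Finset.mul_sum, c1, ← Finset.mul_sum] at h
      exact_mod_cast h
    · intro a _
      have h3 : (a % 2 = 0 ∧ (a : ℤ) % 2 = 0) ∨ (a % 2 = 1 ∧ (a : ℤ) % 2 = 1) := by omega
      rcases h3 with ⟨h, h'⟩ | ⟨h, h'⟩ <;> simp [h, h']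
  · rw [weightedSigmaConj_weights 3 (n + 1) fun a => a % 2]
    · rw [h1m]
      exact_mod_cast h
    · intro a _
      have h3 : (a % 2 = 0 ∧ (a : ℤ) % 2 = 0) ∨ (a % 2 = 1 ∧ (a : ℤ) % 2 = 1) := by omega
      rcases h3 with ⟨h, h'⟩ | ⟨h, h'⟩ <;> simp [h, h']

end Triangles

theorem mainTheorem4 :
    (∀ n : ℕ, 1 ≤ n →
      (squareReps 2 n : ℂ) = 4 * weightedSigma 0 n (weights 4 ![0, 1, 0, -1]) ∧
      ((squareReps 4 n : ℂ) = 8 * weightedSigma 1 n (weights 4 ![0, 1, 1, 1]) ∧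
        (squareReps 4 n : ℂ) = 8 * weightedSigmaConj 1 n (weights 4 ![-3, 1, 1, 1])) ∧
      (squareReps 6 n : ℂ) =
        16 * weightedSigmaConj 2 n (weights 4 ![0, 1, 0, -1]) -
          4 * weightedSigma 2 n (weights 4 ![0, 1, 0, -1]) ∧
      ((squareReps 8 n : ℂ) = 4 * weightedSigma 3 n (weights 4 ![4, 4, 3, 4]) ∧
        (squareReps 8 n : ℂ) = 16 * weightedSigmaConj 3 n (weights 4 ![15, 1, -1, 1]))) ∧
    (∀ n : ℕ,
      ((triangleReps 2 n : ℂ) =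
          4 * weightedSigma 0 (4 * n + 1) (weights 8 ![0, 1, -1, -1, 0, 1, 1, -1]) ∧
        (triangleReps 2 n : ℂ) = 4 * weightedSigma 0 (8 * n + 2) (weights 4 ![0, 1, 0, -1])) ∧
      ((triangleReps 4 n : ℂ) = 8 * weightedSigma 1 (2 * n + 1) (weights 4 ![0, 2, -1, 2]) ∧
        (triangleReps 4 n : ℂ) = 16 * weightedSigmaConj 1 (2 * n + 1) (weights 4 ![0, 1, -2, 1]) ∧
        (triangleReps 4 n : ℂ) = 16 * weightedSigma 1 (2 * n + 1) (weights 1 ![1]) ∧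
        (triangleReps 4 n : ℂ) = 16 * weightedSigmaConj 1 (2 * n + 1) (weights 1 ![1])) ∧
      ((triangleReps 6 n : ℂ) =
          weightedSigma 2 (4 * n + 3) (weights 8 ![0, -4, 1, 4, 0, -4, -1, 4]) +
            4 * weightedSigmaConj 2 (4 * n + 3) (weights 8 ![0, 1, -4, -1, 0, 1, 4, -1]) ∧
        (triangleReps 6 n : ℂ) = 8 * weightedSigma 2 (4 * n + 3) (weights 4 ![0, -1, 0, 1])) ∧
      ((triangleReps 8 n : ℂ) = 4 * weightedSigma 3 (2 * n + 2) (weights 4 ![7, 0, 8, 0]) ∧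
        (triangleReps 8 n : ℂ) = 256 * weightedSigmaConj 3 (2 * n + 2) (weights 4 ![0, 0, 1, 0]) ∧
        (triangleReps 8 n : ℂ) = 32 * weightedSigma 3 (n + 1) (weights 2 ![7, 8]) ∧
        (triangleReps 8 n : ℂ) = 256 * weightedSigmaConj 3 (n + 1) (weights 2 ![0, 1]))) := by
  exact ⟨fun n hn => ⟨squareReps_two hn, squareReps_four hn, squareReps_six hn,
    squareReps_eight hn⟩, fun n => ⟨triangleReps_two n, triangleReps_four n, triangleReps_six n,
    triangleReps_eight n⟩⟩
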